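/- Fourth-order stability of diffusion learning with local updates and partial agent participation. Setting. There are \(K\ge 1\) agents; agent \(k\) holds data \(x_{k,1},\dots,x_{k,N_k}\) (\(N_k\ge 1\)), losses \(Q_k(w;x_{k,n})\), \(w\in\mathbb R^M\), and the risk \(J_k(w)=\frac1{N_k}\sum_{n=1}^{N_k}Q_k(w;x_{k,n})\). Assume: (1) The matrix \(A=[a_{\ell k}]\in\mathbb R^{K\times K}\) is symmetric, has nonnegative entries, satisfies \(A^{\mathsf T}\mathbf 1=\mathbf 1\), and is primitive (some power of \(A\) has only strictly positive entries). (2) For some \(\nu>0\) and \(\delta\): each \(J_k\) is \(\nu\)-strongly convex, i.e. \(J_k(w_2)\ge J_k(w_1)+\nabla J_k(w_1)^{\mathsf T}(w_2-w_1)+\frac\nu2\|w_2-w_1\|^2\) for all \(w_1,w_2\); each \(Q_k(\cdot;x_{k,n})\) is convex and twice differentiable, with \(\|\nabla Q_k(w_2;x_{k,n})-\nabla Q_k(w_1;x_{k,n})\|\le\delta\|w_2-w_1\|\) for all \(w_1,w_2\). Algorithm. Fix an integer \(T\ge 1\), activation probabilities \(q_k\in(0,1]\) and a step size \(\mu>0\).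 In every block \(i=0,1,2,\dots\), agent \(k\) is active with probability \(q_k\); put \(\boldsymbol\mu_{k,i}=\mu\) if \(k\) is active in block \(i\), and \(\boldsymbol\mu_{k,i}=0\) otherwise. At every time \(m\ge 1\), an index \(\boldsymbol n_{k,m}\) is drawn uniformly from \(\{1,\dots,N_k\}\), for every \(k\). All activations and all draws, over all agents, blocks and times, are mutually independent. Starting from \(\boldsymbol w_{k,0}=0\), for \(i\ge 0\), \(1\le t\le T\) and all \(k\), \[ \boldsymbol w_{k,iT+t}=\sum_{\ell=1}^K \boldsymbol a_{\ell k,iT+t}\Big(\boldsymbol w_{\ell,iT+t-1}-\boldsymbol\mu_{\ell,i}\nabla Q_\ell\big(\boldsymbol w_{\ell,iT+t-1};x_{\ell,\boldsymbol n_{\ell,iT+t}}\big)\Big). \] Here for \(t\ne T\) the matrix \([\boldsymbol a_{\ell k,iT+t}]\) is the identity. For \(t=T\): if \(k\) is inactive in block \(i\), then \(\boldsymbol a_{kk,(i+1)T}=1\) and \(\boldsymbol a_{\ell k,(i+1)T}=0\) for \(\ell\ne k\); if \(k\) is active, then for \(\ell\neq k\) one has \(\boldsymbol a_{\ell k,(i+1)T}=a_{\ell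 k}\) if \(\ell\) is active and \(\boldsymbol a_{\ell k,(i+1)T}=0\) if it is not, while \(\boldsymbol a_{kk,(i+1)T}=1-\sum_{\ell\ne k}\boldsymbol a_{\ell k,(i+1)T}\). Let \(w^o=\arg\min_{w\in\mathbb R^M}\frac1K\sum_{k=1}^K q_kJ_k(w)\). Theorem. For small enough \(\mu\) and for every agent \(k=1,\dots,K\), \[ \limsup_{i\to\infty}\mathbb E\|w^o-\boldsymbol w_{k,iT}\|^4=O(\mu^2). \] That is, there are \(\mu_0>0\) and \(C\ge 0\), depending only on the fixed data \((K,M,T,A,q_k,Q_k,x_{k,n})\), such that the left-hand side is at most \(C\mu^2\) for all \(0<\mu<\mu_0\) and every \(k\). -/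

import Mathlib

open MeasureTheory ProbabilityTheory Filter
open scoped ENNReal

noncomputable section

namespace PartialDiffusion

/-- The space `ℝ^M` of models, with the Euclidean norm. -/
abbrev Model (M : ℕ) : Type := EuclideanSpace ℝ (Fin M)

/-- The combination matrix `A = [a_{ℓ k}]` is symmetric, nonnegative, left-stochastic
(`Aᵀ 𝟙 = 𝟙`) and primitive. -/
structure IsCombinationMatrix {K : ℕ} (A : Matrix (Fin K) (Fin K) ℝ) : Prop where
  symm : ∀ l k, A l k = A k l
  nonneg : ∀ l k, 0 ≤ A l k
  leftStochastic : ∀ k, ∑ l, A l k = 1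
  primitive : A.IsPrimitive

/-- The local empirical risk `J_k(w) = (1 / N_k) ∑_n Q_k(w; x_{k,n})`. -/
def risk {K M : ℕ} {X : Type*} {N : Fin K → ℕ}
    (Q : Fin K → Model M → X → ℝ) (x : ∀ k, Fin (N k) → X) (k : Fin K) (w : Model M) : ℝ :=
  (1 / (N k : ℝ)) * ∑ n, Q k w (x k n)

/-- The activation-weighted global risk `(1 / K) ∑_k q_k J_k(w)`, whose minimizer is `w^o`. -/
def weightedRisk {K M : ℕ} {X : Type*} {N : Fin K → ℕ}
    (Q : Fin K → Model M → X → ℝ) (x : ∀ k, Fin (N k) → X) (q : Fin K → ℝ) (w : Model M) : ℝ :=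
  (1 / (K : ℝ)) * ∑ k, q k * risk Q x k w

/-- The risks are `ν`-strongly convex; the losses at the data points are twice differentiable and
convex, with `δ`-Lipschitz gradients. -/
structure IsRegularLoss {K M : ℕ} {X : Type*} {N : Fin K → ℕ}
    (Q : Fin K → Model M → X → ℝ) (x : ∀ k, Fin (N k) → X) (ν δ : ℝ) : Prop where
  differentiable : ∀ k n, Differentiable ℝ (fun w => Q k w (x k n))
  differentiable_gradient : ∀ k n, Differentiable ℝ (gradient (fun w => Q k w (x k n)))
  stronglyConvex : ∀ k (w₁ w₂ : Model M),
    risk Q x k w₁ + inner ℝ (gradient (risk Q x k) w₁) (w₂ - w₁) + ν / 2 * ‖w₂ - w₁‖ ^ 2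
      ≤ risk Q x k w₂
  convex : ∀ k n (w₁ w₂ : Model M),
    Q k w₁ (x k n) + inner ℝ (gradient (fun w => Q k w (x k n)) w₁) (w₂ - w₁) ≤ Q k w₂ (x k n)
  lipschitz_gradient : ∀ k n (w₁ w₂ : Model M),
    ‖gradient (fun w => Q k w (x k n)) w₂ - gradient (fun w => Q k w (x k n)) w₁‖
      ≤ δ * ‖w₂ - w₁‖

/-- The neighbours of agent `k` other than `k` itself that are active. -/
def activeNeighbors {K : ℕ} (A : Matrix (Fin K) (Fin K) ℝ) (active : Fin K → Bool) (k : Fin K) :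
    Finset (Fin K) :=
  Finset.univ.filter (fun j => j ≠ k ∧ A j k ≠ 0 ∧ active j = true)

/-- The combination matrix used at the end of a block, as a function of the activation pattern:
an active agent keeps the weights of its active neighbours and gives the remaining weight to
itself; an inactive agent keeps its own model. -/
def blockMatrix {K : ℕ} (A : Matrix (Fin K) (Fin K) ℝ) (active : Fin K → Bool) :
    Matrix (Fin K) (Fin K) ℝ :=
  Matrix.of fun l k =>
    if active k = true then
      if l = k then 1 - ∑ j ∈ activeNeighbors A active k, A j k
      else if l ∈ activeNeighbors A active k then A l k
      else 0
    else if l = k then 1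
    else 0

/-- The combination matrix at time `n = i T + t`, `1 ≤ t ≤ T`: the identity if `t ≠ T`, and the
matrix of the activation pattern of the block if `t = T`. -/
def combinationAt {K : ℕ} (A : Matrix (Fin K) (Fin K) ℝ) (T : ℕ) (active : Fin K → Bool) (n : ℕ) :
    Matrix (Fin K) (Fin K) ℝ :=
  if T ∣ n then blockMatrix A active else 1

/-- The step size of an agent in a block: `μ` if it is active, `0` otherwise. -/
def stepSize (μ : ℝ) (active : Bool) : ℝ := if active = true then μ else 0

/-- One realization of the models `w_{k,n}`, for an activation pattern `active i` of every block
`i = 0, 1, …` and sampled data indices `sample n` at every time `n = 1, 2, …`. All models start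
at `0`. The time `n + 1 = i T + t` with `1 ≤ t ≤ T` belongs to the block `i = n / T`. -/
def iterate {K M : ℕ} {X : Type*} {N : Fin K → ℕ}
    (A : Matrix (Fin K) (Fin K) ℝ) (Q : Fin K → Model M → X → ℝ) (x : ∀ k, Fin (N k) → X)
    (T : ℕ) (μ : ℝ) (active : ℕ → Fin K → Bool) (sample : ℕ → ∀ k, Fin (N k)) :
    ℕ → Fin K → Model M
  | 0 => fun _ => 0
  | n + 1 => fun k =>
      ∑ l, combinationAt A T (active (n / T)) (n + 1) l k •
        (iterate A Q x T μ active sample n l -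
          stepSize μ (active (n / T) l) •
            gradient (fun w => Q l w (x l (sample (n + 1) l)))
              (iterate A Q x T μ active sample n l))

/-- The randomness of the algorithm: agent `k` is active in each block with probability `q_k`, the
data indices are uniform, and all activations and all samples are mutually independent. -/
structure IsAlgorithmRandomness {K : ℕ} {N : Fin K → ℕ} (q : Fin K → ℝ)
    {Ω : Type*} [MeasurableSpace Ω] (P : Measure Ω)
    (active : ℕ → Fin K → Ω → Bool) (sample : ℕ → ∀ k : Fin K, Ω → Fin (N k)) : Prop where
  measurable_active : ∀ i k, Measurable (active i k)
  measurable_sample : ∀ n k, Measurable (sample n k)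
  prob_active : ∀ i k, P {ω | active i k ω = true} = ENNReal.ofReal (q k)
  prob_sample : ∀ n k (j : Fin (N k)), P {ω | sample n k ω = j} = (N k : ℝ≥0∞)⁻¹
  indep : iIndep
    (Sum.elim
      (fun p : ℕ × Fin K => MeasurableSpace.comap (active p.1 p.2) ⊤)
      (fun p : ℕ × Fin K => MeasurableSpace.comap (sample p.1 p.2) ⊤)) P

end PartialDiffusion

end

open PartialDiffusion

/-!
The models are compared with `wo` through two quantities at the block boundaries: the error of the
centroid (the average of the models of all agents) and the disagreement (the Euclidean norm of the
deviations from the centroid). The Lyapunov function is the sum of their fourth powers.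

*Disagreement.* The block matrix is symmetric and doubly stochastic whatever the activation pattern,
so mixing never increases the disagreement. With probability `∏ k, q k > 0` all agents are active and
the block matrix is `A`, whose primitivity gives a factor `lam < 1` on families with sum zero
(`exists_contractsZeroSum_of_isPrimitive`). The gradients contribute `O(μ)` to the disagreement, so
its fourth moment is contracted by a factor independent of `μ`, up to `O(μ ^ 4)`.

*Centroid.* Mixing preserves the centroid, so over a block it moves by `-μ g` for the average `g` of
the local gradients of the active agents. Replacing all gradients by those at the centroid costs the
disagreement plus a drift of order `μ` (`exists_blockStep_bounds`); the mean of what remains is `T`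
times the gradient of `weightedRisk`, which is strongly monotone around `wo`. In the expansion of the
fourth power (`norm_sub_smul_pow_four_le`) this gives contraction by `1 - O(μ)`, and after Young's
inequality the largest noise term is `μ ^ 2 ‖error‖ ^ 2 ≤ μ (ε ‖error‖ ^ 4 + O(μ ^ 2))`.

Together, the Lyapunov function contracts by `1 - b μ` per block in mean, up to `C μ ^ 3`
(`exists_lyapunov_bound`, `exists_expected_lyapunov_le`). The models at the beginning of a block are
independent of its randomness (`IsAlgorithmRandomness.indepFun_iterate`), so the inequality holds for
expectations, and its iteration leaves an upper limit of at most `C μ ^ 2 / b`.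
-/

noncomputable section

namespace PartialDiffusion

/-! ### Mixing by doubly stochastic matrices -/

section Mixing

variable {ι E : Type*} [Fintype ι] [NormedAddCommGroup E]

/-- The Euclidean norm of a family of vectors, i.e. of the concatenated vector. -/
def familyNorm (v : ι → E) : ℝ := ‖WithLp.toLp 2 v‖

lemma familyNorm_nonneg (v : ι → E) : 0 ≤ familyNorm v := norm_nonneg _

lemma familyNorm_sq (v : ι → E) : familyNorm v ^ 2 = ∑ k, ‖v k‖ ^ 2 :=
  PiLp.norm_sq_eq_of_L2 _ _

lemma norm_le_familyNorm (v : ι → E) (k : ι) : ‖v k‖ ≤ familyNorm v :=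
  PiLp.norm_apply_le (WithLp.toLp 2 v) k

lemma familyNorm_sub_le (v w : ι → E) :
    familyNorm (fun k => v k - w k) ≤ familyNorm v + familyNorm w :=
  norm_sub_le (WithLp.toLp 2 v) (WithLp.toLp 2 w)

lemma familyNorm_le_of_forall_le {v : ι → E} {a : ℝ} (ha : 0 ≤ a) (h : ∀ k, ‖v k‖ ≤ a) :
    familyNorm v ≤ Fintype.card ι * a := by
  have h1 : familyNorm v ^ 2 ≤ (Fintype.card ι * a) ^ 2 := by
    rw [familyNorm_sq]
    calc ∑ k, ‖v k‖ ^ 2 ≤ (∑ k, ‖v k‖) ^ 2 :=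
          Finset.sum_sq_le_sq_sum_of_nonneg fun k _ => norm_nonneg _
      _ ≤ (∑ _k : ι, a) ^ 2 := by gcongr with k; exact h k
      _ = _ := by simp
  exact (sq_le_sq₀ (familyNorm_nonneg v) (by positivity)).1 h1

variable [InnerProductSpace ℝ E]

lemma familyNorm_smul (a : ℝ) (v : ι → E) :
    familyNorm (fun k => a • v k) = |a| * familyNorm v :=
  norm_smul a (WithLp.toLp 2 v)

/-- The combination step `k ↦ ∑ l, B l k • v l`. The matrix acts through its transpose, as it does
in `iterate`. -/
def mix (B : Matrix ι ι ℝ) (v : ι → E) : ι → E := fun k => ∑ l, B l k • v l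

lemma mix_mul (B C : Matrix ι ι ℝ) (v : ι → E) : mix (B * C) v = mix C (mix B v) := by
  funext k
  simp only [mix, Matrix.mul_apply, Finset.sum_smul, Finset.smul_sum, smul_smul]
  rw [Finset.sum_comm]
  simp only [mul_comm]

lemma mix_sub (B : Matrix ι ι ℝ) (v w : ι → E) :
    mix B (fun k => v k - w k) = fun k => mix B v k - mix B w k := by
  funext k
  simp [mix, smul_sub]

lemma mix_const {B : Matrix ι ι ℝ} (hB : ∀ k, ∑ l, B l k = 1) (c : E) :
    mix B (fun _ => c) = fun _ => c := by
  funext k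
  simp [mix, ← Finset.sum_smul, hB]

lemma sum_mix {B : Matrix ι ι ℝ} (hB : ∀ l, ∑ k, B l k = 1) (v : ι → E) :
    ∑ k, mix B v k = ∑ k, v k := by
  simp only [mix]
  rw [Finset.sum_comm]
  simp [← Finset.sum_smul, hB]

/-- The Schur test for a nonnegative matrix with all row and column sums equal to `s`. -/
lemma familyNorm_mix_le {B : Matrix ι ι ℝ} {s : ℝ} (hs : 0 ≤ s) (hB : ∀ l k, 0 ≤ B l k)
    (hcol : ∀ k, ∑ l, B l k = s) (hrow : ∀ l, ∑ k, B l k = s) (v : ι → E) :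
    familyNorm (mix B v) ≤ s * familyNorm v := by
  have key : ∀ k, ‖mix B v k‖ ^ 2 ≤ s * ∑ l, B l k * ‖v l‖ ^ 2 := by
    intro k
    calc ‖mix B v k‖ ^ 2 ≤ (∑ l, B l k * ‖v l‖) ^ 2 := by
          gcongr
          refine (norm_sum_le _ _).trans (le_of_eq ?_)
          simp [norm_smul, abs_of_nonneg (hB _ k)]
      _ ≤ (∑ l, B l k) * ∑ l, B l k * ‖v l‖ ^ 2 := by
          refine Finset.sum_sq_le_sum_mul_sum_of_sq_le_mul _ (fun l _ => hB l k)
            (fun l _ => mul_nonneg (hB l k) (sq_nonneg _)) fun l _ => le_of_eq (by ring)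
      _ = _ := by rw [hcol]
  have h1 : familyNorm (mix B v) ^ 2 ≤ (s * familyNorm v) ^ 2 := by
    rw [mul_pow, familyNorm_sq, familyNorm_sq]
    calc ∑ k, ‖mix B v k‖ ^ 2 ≤ ∑ k, s * ∑ l, B l k * ‖v l‖ ^ 2 :=
          Finset.sum_le_sum fun k _ => key k
      _ = s * ∑ l, (∑ k, B l k) * ‖v l‖ ^ 2 := by
          rw [← Finset.mul_sum, Finset.sum_comm]
          simp [Finset.sum_mul]
      _ = _ := by
          simp only [hrow, ← Finset.mul_sum]
          ring
  exact (sq_le_sq₀ (familyNorm_nonneg _) (mul_nonneg hs (familyNorm_nonneg v))).1 h1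

variable (E) in
/-- Mixing by `B` shrinks families of vectors with sum zero by the factor `r`. -/
def ContractsZeroSum (B : Matrix ι ι ℝ) (r : ℝ) : Prop :=
  ∀ v : ι → E, ∑ k, v k = 0 → familyNorm (mix B v) ≤ r * familyNorm v

/-- For a symmetric matrix, `‖B v‖² = ⟨v, B² v⟩ ≤ ‖v‖ ‖B² v‖`, so that a contraction factor of `B²`
gives one of `B`. -/
lemma ContractsZeroSum.of_mul_self {B : Matrix ι ι ℝ} (hB : ∀ l k, B l k = B k l) {r : ℝ}
    (hr : 0 ≤ r) (h : ContractsZeroSum E (B * B) r) : ContractsZeroSum E B √r := by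
  intro v hv
  have h1 : familyNorm (mix B v) ^ 2 = ∑ k, inner ℝ (v k) (mix (B * B) v k) := by
    rw [familyNorm_sq, mix_mul]
    simp only [← real_inner_self_eq_norm_sq]
    conv_lhs => enter [2, k, 2]; unfold mix
    conv_rhs => enter [2, k]; rw [mix]
    simp only [sum_inner, inner_sum, inner_smul_left, inner_smul_right]
    rw [Finset.sum_comm]
    simp [fun l k => hB l k]
  have h2 : familyNorm (mix B v) ^ 2 ≤ (√r * familyNorm v) ^ 2 := by
    rw [h1, mul_pow, Real.sq_sqrt hr]
    have h3 : ∑ k, inner ℝ (v k) (mix (B * B) v k)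
        = inner ℝ (WithLp.toLp 2 v) (WithLp.toLp 2 (mix (B * B) v)) := by
      rw [PiLp.inner_apply]
    rw [h3]
    calc _ ≤ familyNorm v * familyNorm (mix (B * B) v) := real_inner_le_norm _ _
      _ ≤ familyNorm v * (r * familyNorm v) :=
          mul_le_mul_of_nonneg_left (h v hv) (familyNorm_nonneg v)
      _ = _ := by ring
  exact (sq_le_sq₀ (familyNorm_nonneg _)
    (mul_nonneg (Real.sqrt_nonneg _) (familyNorm_nonneg v))).1 h2

variable [DecidableEq ι]

lemma familyNorm_mix_le_of_mem_doublyStochastic {B : Matrix ι ι ℝ}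
    (hB : B ∈ doublyStochastic ℝ ι) (v : ι → E) : familyNorm (mix B v) ≤ familyNorm v := by
  simpa using familyNorm_mix_le zero_le_one (fun l k => nonneg_of_mem_doublyStochastic hB)
    (sum_col_of_mem_doublyStochastic hB) (sum_row_of_mem_doublyStochastic hB) v

lemma exists_contractsZeroSum_of_pow_two_pow {B : Matrix ι ι ℝ} (hB : B.IsSymm) (n : ℕ)
    (h : ∃ r, 0 ≤ r ∧ r < 1 ∧ ContractsZeroSum E (B ^ 2 ^ n) r) :
    ∃ r, 0 ≤ r ∧ r < 1 ∧ ContractsZeroSum E B r := by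
  induction n with
  | zero => simpa using h
  | succ n ih =>
    obtain ⟨r, hr0, hr1, hr⟩ := h
    refine ih ⟨√r, Real.sqrt_nonneg r, by rwa [Real.sqrt_lt' one_pos, one_pow], ?_⟩
    refine ContractsZeroSum.of_mul_self (fun l k => ?_) hr0
      (by rwa [← pow_add, ← two_mul, ← pow_succ'])
    exact ((hB.pow (2 ^ n)).apply l k).symm

/-- A doubly stochastic matrix with entries at least `ε` contracts: subtracting the constant matrix
`ε` does not change its action on families with sum zero, and leaves row and column sums
`1 - card ι * ε`. -/
lemma exists_contractsZeroSum_of_pos [Nonempty ι] {B : Matrix ι ι ℝ}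
    (hB : B ∈ doublyStochastic ℝ ι) (hpos : ∀ l k, 0 < B l k) :
    ∃ r, 0 ≤ r ∧ r < 1 ∧ ContractsZeroSum E B r := by
  obtain ⟨p, hp⟩ := Finite.exists_min (fun p : ι × ι => B p.1 p.2)
  set ε := B p.1 p.2
  have hε : 0 < ε := hpos _ _
  have hcard : 0 < (Fintype.card ι : ℝ) := by exact_mod_cast Fintype.card_pos
  have hsum : ∀ k, ∑ l, (B l k - ε) = 1 - Fintype.card ι * ε := fun k => by
    simp [Finset.sum_sub_distrib, sum_col_of_mem_doublyStochastic hB]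
  have hnonneg : 0 ≤ 1 - Fintype.card ι * ε := by
    rw [← hsum p.1]
    exact Finset.sum_nonneg fun l _ => sub_nonneg.2 (hp (l, p.1))
  refine ⟨1 - Fintype.card ι * ε, hnonneg, by nlinarith, fun v hv => ?_⟩
  have h1 : mix B v = mix (Matrix.of fun l k => B l k - ε) v := by
    funext k
    simp [mix, sub_smul, ← Finset.smul_sum, hv]
  rw [h1]
  refine familyNorm_mix_le hnonneg (fun l k => sub_nonneg.2 (hp (l, k))) hsum (fun l => ?_) v
  simp [Finset.sum_sub_distrib, sum_row_of_mem_doublyStochastic hB]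

/-- A symmetric, doubly stochastic, primitive matrix has second largest eigenvalue modulus below
one. -/
lemma exists_contractsZeroSum_of_isPrimitive [Nonempty ι] {B : Matrix ι ι ℝ} (hsymm : B.IsSymm)
    (hB : B ∈ doublyStochastic ℝ ι) (hprim : B.IsPrimitive) :
    ∃ r, 0 ≤ r ∧ r < 1 ∧ ContractsZeroSum E B r := by
  obtain ⟨m, -, hm⟩ := hprim.exists_pos_pow
  obtain ⟨r, hr0, hr1, hr⟩ :=
    exists_contractsZeroSum_of_pos (E := E) (pow_mem hB m) hm
  refine exists_contractsZeroSum_of_pow_two_pow hsymm m ⟨r, hr0, hr1, fun v hv => ?_⟩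
  -- `m ≤ 2 ^ m`, and the remaining power of `B` does not increase the norm
  have hsplit : 2 ^ m = m + (2 ^ m - m) := by have := (Nat.lt_two_pow_self (n := m)).le; omega
  rw [hsplit, pow_add, mix_mul]
  exact (familyNorm_mix_le_of_mem_doublyStochastic (pow_mem hB _) _).trans (hr v hv)

end Mixing

/-! ### The combination matrix of a block -/

section BlockMatrix

variable {K : ℕ} {A : Matrix (Fin K) (Fin K) ℝ}

lemma IsCombinationMatrix.isSymm (hA : IsCombinationMatrix A) : A.IsSymm :=
  Matrix.IsSymm.ext fun l k => hA.symm k l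

lemma IsCombinationMatrix.mem_doublyStochastic (hA : IsCombinationMatrix A) :
    A ∈ doublyStochastic ℝ (Fin K) :=
  mem_doublyStochastic_iff_sum.2 ⟨hA.nonneg,
    fun l => by simpa only [hA.symm l] using hA.leftStochastic l, hA.leftStochastic⟩

lemma blockMatrix_symm (hA : IsCombinationMatrix A) (active : Fin K → Bool) (l k : Fin K) :
    blockMatrix A active l k = blockMatrix A active k l := by
  rcases eq_or_ne l k with rfl | h
  · rfl
  · simp only [blockMatrix, Matrix.of_apply, activeNeighbors, Finset.mem_filter, Finset.mem_univ,
      true_and, h, h.symm, if_false, ne_eq, not_false_eq_true, hA.symm k l]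
    cases active l <;> cases active k <;> simp

lemma sum_blockMatrix (active : Fin K → Bool) (k : Fin K) :
    ∑ l, blockMatrix A active l k = 1 := by
  cases hk : active k
  · simp [blockMatrix, hk]
  · have h1 : ∀ l, blockMatrix A active l k
        = (if l = k then 1 - ∑ j ∈ activeNeighbors A active k, A j k else 0)
          + (if l ∈ activeNeighbors A active k then A l k else 0) := by
      intro l
      by_cases hl : l = k
      · subst hl; simp [blockMatrix, hk, activeNeighbors]
      · simp [blockMatrix, hk, hl]
    simp [h1, Finset.sum_add_distrib]

lemma blockMatrix_mem_doublyStochastic (hA : IsCombinationMatrix A) (active : Fin K → Bool) :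
    blockMatrix A active ∈ doublyStochastic ℝ (Fin K) := by
  refine mem_doublyStochastic_iff_sum.2 ⟨fun l k => ?_, fun l => ?_, sum_blockMatrix active⟩
  · have h1 : ∑ j ∈ activeNeighbors A active k, A j k ≤ 1 := by
      rw [← hA.leftStochastic k]
      exact Finset.sum_le_sum_of_subset_of_nonneg (Finset.subset_univ _)
        fun j _ _ => hA.nonneg j k
    have h2 := hA.nonneg l k
    simp only [blockMatrix, Matrix.of_apply]
    split_ifs <;> linarith
  · simpa only [blockMatrix_symm hA active l] using sum_blockMatrix active l

lemma blockMatrix_of_forall_active (hA : IsCombinationMatrix A) {active : Fin K → Bool}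
    (h : ∀ k, active k = true) : blockMatrix A active = A := by
  ext l k
  have h1 : ∑ j ∈ activeNeighbors A active k, A j k = 1 - A k k := by
    rw [← hA.leftStochastic k, ← Finset.sum_erase_eq_sub (Finset.mem_univ k)]
    refine Finset.sum_subset (fun j hj => ?_) fun j hj hj' => ?_
    · simp only [activeNeighbors, Finset.mem_filter] at hj
      simp [hj.2.1]
    · by_contra h0
      exact hj' (by simp [activeNeighbors, h, h0, Finset.ne_of_mem_erase hj])
  simp only [blockMatrix, Matrix.of_apply, h, if_true, h1]
  by_cases hl : l = k
  · simp [hl]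
  · by_cases h0 : A l k = 0 <;> simp [activeNeighbors, hl, h0, h]

end BlockMatrix

/-! ### Gradients of the losses -/

section Gradient

variable {K M : ℕ} {X : Type*} {N : Fin K → ℕ} {Q : Fin K → Model M → X → ℝ}
  {x : ∀ k, Fin (N k) → X} {ν δ : ℝ}

/-- The gradient of the loss of agent `k` at its `n`-th data point. -/
def lossGradient (Q : Fin K → Model M → X → ℝ) (x : ∀ k, Fin (N k) → X) (k : Fin K)
    (n : Fin (N k)) : Model M → Model M :=
  gradient (fun w => Q k w (x k n))

lemma IsRegularLoss.hasGradientAt_risk (hQ : IsRegularLoss Q x ν δ) (k : Fin K) (w : Model M) :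
    HasGradientAt (risk Q x k) ((1 / (N k : ℝ)) • ∑ n, lossGradient Q x k n w) w := by
  rw [hasGradientAt_iff_hasFDerivAt, map_smul, map_sum]
  exact (HasFDerivAt.fun_sum fun n _ =>
    (hQ.differentiable k n w).hasGradientAt.hasFDerivAt).const_mul (1 / (N k : ℝ))

/-- The gradient of a strongly convex risk is strongly monotone: add the two strong convexity
inequalities between the points. -/
lemma IsRegularLoss.le_inner_gradient_risk (hQ : IsRegularLoss Q x ν δ) (k : Fin K)
    (w₁ w₂ : Model M) : ν * ‖w₂ - w₁‖ ^ 2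
      ≤ inner ℝ (gradient (risk Q x k) w₂ - gradient (risk Q x k) w₁) (w₂ - w₁) := by
  have h1 := hQ.stronglyConvex k w₁ w₂
  have h2 := hQ.stronglyConvex k w₂ w₁
  rw [norm_sub_rev w₁ w₂, ← neg_sub w₂ w₁, inner_neg_right] at h2
  rw [inner_sub_left]
  linarith

lemma IsRegularLoss.sum_smul_gradient_risk_eq_zero (hQ : IsRegularLoss Q x ν δ) (hK : 0 < K)
    {q : Fin K → ℝ} {wo : Model M} (hwo : ∀ w, weightedRisk Q x q wo ≤ weightedRisk Q x q w) :
    ∑ k, q k • gradient (risk Q x k) wo = 0 := by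
  have h1 : HasGradientAt (weightedRisk Q x q)
      ((1 / (K : ℝ)) • ∑ k, q k • gradient (risk Q x k) wo) wo := by
    rw [hasGradientAt_iff_hasFDerivAt, map_smul, map_sum]
    refine (HasFDerivAt.fun_sum fun k _ => ?_).const_mul (1 / (K : ℝ))
    rw [map_smul]
    exact (hQ.hasGradientAt_risk k wo).differentiableAt.hasGradientAt.hasFDerivAt.const_mul (q k)
  have h2 : IsLocalMin (weightedRisk Q x q) wo := Filter.Eventually.of_forall hwo
  have h3 := h2.hasFDerivAt_eq_zero h1.hasFDerivAt
  have h4 : (1 / (K : ℝ)) ≠ 0 := by positivity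
  exact (smul_eq_zero.1 ((LinearIsometryEquiv.map_eq_zero_iff _).1 h3)).resolve_left h4

/-- The mean update direction, over active agents and samples, is strongly monotone around the
minimizer of the activation-weighted risk. -/
lemma IsRegularLoss.le_inner_mean_lossGradient (hQ : IsRegularLoss Q x ν δ) (hK : 0 < K)
    {q : Fin K → ℝ} (hq : ∀ k, 0 < q k) {wo : Model M}
    (hwo : ∀ w, weightedRisk Q x q wo ≤ weightedRisk Q x q w) (w : Model M) :
    (ν * ∑ k, q k) * ‖w - wo‖ ^ 2
      ≤ inner ℝ (∑ k, (q k / N k) • ∑ n, lossGradient Q x k n w) (w - wo) := by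
  have h1 : ∑ k, (q k / N k) • ∑ n, lossGradient Q x k n w
      = ∑ k, q k • (gradient (risk Q x k) w - gradient (risk Q x k) wo) := by
    simp only [smul_sub, Finset.sum_sub_distrib, hQ.sum_smul_gradient_risk_eq_zero hK hwo, sub_zero]
    refine Finset.sum_congr rfl fun k _ => ?_
    rw [(hQ.hasGradientAt_risk k w).gradient, smul_smul, mul_one_div]
  rw [h1, sum_inner, Finset.mul_sum, Finset.sum_mul]
  refine Finset.sum_le_sum fun k _ => ?_
  rw [real_inner_smul_left]
  nlinarith [mul_le_mul_of_nonneg_left (hQ.le_inner_gradient_risk k wo w) (hq k).le]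

/-- All maps `G k n` are `L`-Lipschitz and grow at most linearly away from `wo`. -/
structure IsLipschitzOracle (G : ∀ k, Fin (N k) → Model M → Model M) (wo : Model M) (L : ℝ) :
    Prop where
  nonneg : 0 ≤ L
  lipschitz : ∀ k n u v, ‖G k n u - G k n v‖ ≤ L * ‖u - v‖
  growth : ∀ k n u, ‖G k n u‖ ≤ L * (1 + ‖u - wo‖)

lemma IsRegularLoss.exists_isLipschitzOracle (hQ : IsRegularLoss Q x ν δ) (wo : Model M) :
    ∃ L, IsLipschitzOracle (lossGradient Q x) wo L := by
  set S := ∑ k, ∑ n, ‖lossGradient Q x k n wo‖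
  have hS : ∀ k n, ‖lossGradient Q x k n wo‖ ≤ S := fun k n =>
    (Finset.single_le_sum (f := fun n => ‖lossGradient Q x k n wo‖)
      (fun _ _ => norm_nonneg _) (Finset.mem_univ n)).trans
    (Finset.single_le_sum (f := fun k => ∑ n, ‖lossGradient Q x k n wo‖)
      (fun _ _ => Finset.sum_nonneg fun _ _ => norm_nonneg _) (Finset.mem_univ k))
  have hS0 : 0 ≤ S := Finset.sum_nonneg fun _ _ => Finset.sum_nonneg fun _ _ => norm_nonneg _
  have hlip : ∀ k n u v, ‖lossGradient Q x k n u - lossGradient Q x k n v‖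
      ≤ (|δ| + S) * ‖u - v‖ := fun k n u v =>
    (hQ.lipschitz_gradient k n v u).trans
      (mul_le_mul_of_nonneg_right ((le_abs_self δ).trans (by linarith)) (norm_nonneg _))
  refine ⟨|δ| + S, by positivity, hlip, fun k n u => ?_⟩
  have h1 := norm_le_norm_add_norm_sub' (lossGradient Q x k n u) (lossGradient Q x k n wo)
  have h2 := hlip k n u wo
  have h3 := hS k n
  nlinarith [abs_nonneg δ]

end Gradient

/-! ### Local updates during a block -/

section LocalUpdate

variable {K M : ℕ} {N : Fin K → ℕ} {G : ∀ k, Fin (N k) → Model M → Model M} {L : ℝ}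
  {wo : Model M}

/-- The models after `t` local updates from `W`, for gradient oracles `G k n`. -/
def localIterate (G : ∀ k, Fin (N k) → Model M → Model M) (μ : ℝ) (active : Fin K → Bool)
    (sample : ℕ → ∀ k, Fin (N k)) (W : Fin K → Model M) : ℕ → Fin K → Model M
  | 0 => W
  | t + 1 => fun k => localIterate G μ active sample W t k -
      stepSize μ (active k) • G k (sample t k) (localIterate G μ active sample W t k)

/-- The sum of the first `T` local gradients that agent `k` uses; zero if it is inactive. -/
def localDirection (G : ∀ k, Fin (N k) → Model M → Model M) (μ : ℝ) (active : Fin K → Bool)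
    (sample : ℕ → ∀ k, Fin (N k)) (W : Fin K → Model M) (T : ℕ) (k : Fin K) : Model M :=
  ∑ t ∈ Finset.range T,
    if active k = true then G k (sample t k) (localIterate G μ active sample W t k) else 0

lemma localIterate_eq (μ : ℝ) (active : Fin K → Bool) (sample : ℕ → ∀ k, Fin (N k))
    (W : Fin K → Model M) (T : ℕ) (k : Fin K) :
    localIterate G μ active sample W T k
      = W k - μ • localDirection G μ active sample W T k := by
  induction T with
  | zero => simp [localIterate, localDirection]
  | succ T ih =>
    rw [localDirection, Finset.sum_range_succ, ← localDirection, smul_add, ← sub_sub, ← ih]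
    cases h : active k <;> simp [localIterate, stepSize, h]


lemma norm_localIterate_sub_le (hG : IsLipschitzOracle G wo L) {μ : ℝ} (hμ0 : 0 ≤ μ) (hμ1 : μ ≤ 1)
    (active : Fin K → Bool) (sample : ℕ → ∀ k, Fin (N k)) (W : Fin K → Model M) (t : ℕ)
    (k : Fin K) :
    1 + ‖localIterate G μ active sample W t k - wo‖ ≤ (1 + L) ^ t * (1 + ‖W k - wo‖) := by
  have hL := hG.nonneg
  induction t with
  | zero => simp [localIterate]
  | succ t ih =>
    set w := localIterate G μ active sample W t k with hw
    have h1 : ‖stepSize μ (active k) • G k (sample t k) w‖ ≤ L * (1 + ‖w - wo‖) := by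
      have hs : ‖stepSize μ (active k)‖ ≤ 1 := by
        rw [Real.norm_eq_abs, abs_le]
        unfold stepSize
        split_ifs <;> constructor <;> linarith
      rw [norm_smul]
      exact (mul_le_of_le_one_left (norm_nonneg _) hs).trans (hG.growth _ _ _)
    have h2 : ‖localIterate G μ active sample W (t + 1) k - wo‖
        ≤ ‖w - wo‖ + ‖stepSize μ (active k) • G k (sample t k) w‖ := by
      rw [localIterate, sub_right_comm]
      exact norm_sub_le _ _
    calc _ ≤ (1 + L) * (1 + ‖w - wo‖) := by linarith
      _ ≤ (1 + L) * ((1 + L) ^ t * (1 + ‖W k - wo‖)) := by gcongr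
      _ = _ := by ring

lemma norm_localDirection_le (hG : IsLipschitzOracle G wo L) {μ : ℝ} (hμ0 : 0 ≤ μ) (hμ1 : μ ≤ 1)
    (active : Fin K → Bool) (sample : ℕ → ∀ k, Fin (N k)) (W : Fin K → Model M) {t T : ℕ}
    (ht : t ≤ T) (k : Fin K) :
    ‖localDirection G μ active sample W t k‖ ≤ T * L * (1 + L) ^ T * (1 + ‖W k - wo‖) := by
  have hL := hG.nonneg
  have h1 : ∀ s ∈ Finset.range t,
      ‖if active k = true then G k (sample s k) (localIterate G μ active sample W s k) else 0‖
        ≤ L * ((1 + L) ^ T * (1 + ‖W k - wo‖)) := by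
    intro s hs
    have hsT : s ≤ T := (Finset.mem_range.1 hs).le.trans ht
    split_ifs
    · refine (hG.growth _ _ _).trans (mul_le_mul_of_nonneg_left ?_ hL)
      refine (norm_localIterate_sub_le hG hμ0 hμ1 active sample W s k).trans ?_
      gcongr
      linarith
    · rw [norm_zero]; positivity
  calc _ ≤ ∑ _s ∈ Finset.range t, L * ((1 + L) ^ T * (1 + ‖W k - wo‖)) := norm_sum_le_of_le _ h1
    _ = t * (L * ((1 + L) ^ T * (1 + ‖W k - wo‖))) := by simp
    _ ≤ T * (L * ((1 + L) ^ T * (1 + ‖W k - wo‖))) := by gcongr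
    _ = _ := by ring

/-- The local direction differs from the one with all gradients taken at a fixed point `z` by the
distance to `z` and the `O(μ)` drift of the local models. -/
lemma norm_localDirection_sub_le (hG : IsLipschitzOracle G wo L) {μ : ℝ} (hμ0 : 0 ≤ μ)
    (hμ1 : μ ≤ 1) (active : Fin K → Bool) (sample : ℕ → ∀ k, Fin (N k)) (W : Fin K → Model M)
    (T : ℕ) (k : Fin K) (z : Model M) :
    ‖localDirection G μ active sample W T k
        - ∑ t ∈ Finset.range T, if active k = true then G k (sample t k) z else 0‖
      ≤ T * L * (‖W k - z‖ + μ * (T * L * (1 + L) ^ T * (1 + ‖W k - wo‖))) := by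
  have hL := hG.nonneg
  rw [localDirection, ← Finset.sum_sub_distrib]
  have h1 : ∀ s ∈ Finset.range T,
      ‖(if active k = true then G k (sample s k) (localIterate G μ active sample W s k) else 0)
        - (if active k = true then G k (sample s k) z else 0)‖
        ≤ L * (‖W k - z‖ + μ * (T * L * (1 + L) ^ T * (1 + ‖W k - wo‖))) := by
    intro s hs
    split_ifs
    · refine (hG.lipschitz _ _ _ _).trans (mul_le_mul_of_nonneg_left ?_ hL)
      rw [localIterate_eq, sub_right_comm]
      refine (norm_sub_le _ _).trans (add_le_add le_rfl ?_)
      rw [norm_smul, Real.norm_of_nonneg hμ0]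
      exact mul_le_mul_of_nonneg_left
        (norm_localDirection_le hG hμ0 hμ1 active sample W (Finset.mem_range.1 hs).le k) hμ0
    · rw [sub_self, norm_zero]; positivity
  calc _ ≤ ∑ _s ∈ Finset.range T,
        L * (‖W k - z‖ + μ * (T * L * (1 + L) ^ T * (1 + ‖W k - wo‖))) := norm_sum_le_of_le _ h1
    _ = _ := by simp; ring

end LocalUpdate

/-! ### Centroid and disagreement over one block -/

section Block

variable {K M : ℕ} {N : Fin K → ℕ} {G : ∀ k, Fin (N k) → Model M → Model M} {L : ℝ}
  {wo : Model M}

/-- The average of the models of all agents. -/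
def centroid (W : Fin K → Model M) : Model M := (1 / (K : ℝ)) • ∑ k, W k

/-- The deviations of the models from their average. -/
def deviation (W : Fin K → Model M) : Fin K → Model M := fun k => W k - centroid W

/-- The models at the end of a block of length `T`: local updates, then mixing. -/
def blockStep (A : Matrix (Fin K) (Fin K) ℝ) (G : ∀ k, Fin (N k) → Model M → Model M) (T : ℕ)
    (μ : ℝ) (active : Fin K → Bool) (sample : ℕ → ∀ k, Fin (N k)) (W : Fin K → Model M) :
    Fin K → Model M :=
  mix (blockMatrix A active) (localIterate G μ active sample W T)

lemma sum_deviation (W : Fin K → Model M) : ∑ k, deviation W k = 0 := by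
  rcases Nat.eq_zero_or_pos K with rfl | hK
  · simp
  · have : (K : ℝ) ≠ 0 := by positivity
    simp [deviation, centroid, Finset.sum_sub_distrib, ← Nat.cast_smul_eq_nsmul ℝ, smul_smul, this]

lemma centroid_sub_smul (W γ : Fin K → Model M) (μ : ℝ) :
    centroid (fun k => W k - μ • γ k) = centroid W - μ • centroid γ := by
  simp [centroid, Finset.sum_sub_distrib, smul_sub, ← Finset.smul_sum, smul_comm μ]

lemma centroid_sub (W γ : Fin K → Model M) :
    centroid (fun k => W k - γ k) = centroid W - centroid γ := by
  simp [centroid, Finset.sum_sub_distrib, smul_sub]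

lemma norm_centroid_le {γ : Fin K → Model M} {a : ℝ} (ha : 0 ≤ a) (h : ∀ k, ‖γ k‖ ≤ a) :
    ‖centroid γ‖ ≤ a := by
  rcases Nat.eq_zero_or_pos K with rfl | hK
  · simpa [centroid] using ha
  · have hK' : (0 : ℝ) < K := by positivity
    rw [centroid, norm_smul, Real.norm_of_nonneg (by positivity), one_div, inv_mul_le_iff₀ hK']
    calc ‖∑ k, γ k‖ ≤ ∑ _k : Fin K, a := norm_sum_le_of_le _ fun k _ => h k
      _ = K * a := by simp

lemma centroid_mix {B : Matrix (Fin K) (Fin K) ℝ} (hB : B ∈ doublyStochastic ℝ (Fin K))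
    (W : Fin K → Model M) : centroid (mix B W) = centroid W := by
  rw [centroid, sum_mix (sum_row_of_mem_doublyStochastic hB), centroid]

lemma deviation_mix {B : Matrix (Fin K) (Fin K) ℝ} (hB : B ∈ doublyStochastic ℝ (Fin K))
    (W : Fin K → Model M) : deviation (mix B W) = mix B (deviation W) := by
  unfold deviation
  rw [mix_sub, mix_const (sum_col_of_mem_doublyStochastic hB), centroid_mix hB]

/-- The direction in which the centroid would move if all agents took their gradients at `z`. -/
def meanDirection (G : ∀ k, Fin (N k) → Model M → Model M) (T : ℕ) (active : Fin K → Bool)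
    (sample : ℕ → ∀ k, Fin (N k)) (z : Model M) : Model M :=
  centroid fun k => ∑ t ∈ Finset.range T, if active k = true then G k (sample t k) z else 0

/-- The pathwise effect of one block on centroid and deviations. With
`Z = 1 + ‖centroid error‖ + disagreement`, the centroid moves by `-μ g` with `‖g‖ ≤ R Z`, and `g`
is the direction at the centroid up to `R (disagreement + μ Z)`; the disagreement grows by at most
`μ R Z`, and is then contracted if all agents are active. -/
lemma exists_blockStep_bounds {A : Matrix (Fin K) (Fin K) ℝ} (hA : IsCombinationMatrix A) {lam : ℝ}
    (hlam0 : 0 ≤ lam) (hlam : ContractsZeroSum (Model M) A lam) (hG : IsLipschitzOracle G wo L)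
    (T : ℕ) :
    ∃ R, 0 ≤ R ∧ ∀ μ, 0 ≤ μ → μ ≤ 1 → ∀ (active : Fin K → Bool) (sample : ℕ → ∀ k, Fin (N k))
      (W : Fin K → Model M) (c D Z : ℝ), c = ‖centroid W - wo‖ → D = familyNorm (deviation W) →
      Z = 1 + c + D →
      (∃ g : Model M, centroid (blockStep A G T μ active sample W) = centroid W - μ • g ∧
        ‖g‖ ≤ R * Z ∧ ‖g - meanDirection G T active sample (centroid W)‖ ≤ R * (D + μ * Z)) ∧
      familyNorm (deviation (blockStep A G T μ active sample W))
        ≤ (if ∀ k, active k = true then lam else 1) * (D + μ * (R * Z)) := by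
  have hL := hG.nonneg
  set R₁ := T * L * (1 + L) ^ T with hR₁
  have hR₁0 : 0 ≤ R₁ := by positivity
  set R₂ := T * L * (1 + R₁) with hR₂
  have hR₂0 : 0 ≤ R₂ := by positivity
  refine ⟨R₁ + R₂ + K * (2 * R₁), by positivity, ?_⟩
  intro μ hμ0 hμ1 active sample W c D Z hc hD hZ
  have hc0 : 0 ≤ c := hc ▸ norm_nonneg _
  have hD0 : 0 ≤ D := hD ▸ familyNorm_nonneg _
  have hZ0 : 0 ≤ Z := by linarith
  have hB := blockMatrix_mem_doublyStochastic hA active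
  set γ := localDirection G μ active sample W T with hγ
  have hloc : localIterate G μ active sample W T = fun k => W k - μ • γ k :=
    funext fun k => localIterate_eq μ active sample W T k
  have hdev : ∀ k, ‖W k - centroid W‖ ≤ D := fun k => hD ▸ norm_le_familyNorm (deviation W) k
  have hWZ : ∀ k, 1 + ‖W k - wo‖ ≤ Z := fun k => by
    have h1 := norm_add_le (W k - centroid W) (centroid W - wo)
    rw [sub_add_sub_cancel] at h1
    linarith [hdev k]
  have hγZ : ∀ k, ‖γ k‖ ≤ R₁ * Z := fun k =>
    (norm_localDirection_le hG hμ0 hμ1 active sample W le_rfl k).trans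
      (mul_le_mul_of_nonneg_left (hWZ k) hR₁0)
  have hgZ : ‖centroid γ‖ ≤ R₁ * Z := norm_centroid_le (by positivity) hγZ
  refine ⟨⟨centroid γ, ?_, ?_, ?_⟩, ?_⟩
  · rw [blockStep, centroid_mix hB, hloc, centroid_sub_smul]
  · refine hgZ.trans (mul_le_mul_of_nonneg_right ?_ hZ0)
    have : 0 ≤ K * (2 * R₁) := by positivity
    linarith
  · rw [meanDirection, ← centroid_sub]
    have h1 : R₂ * (D + μ * Z) ≤ (R₁ + R₂ + K * (2 * R₁)) * (D + μ * Z) := by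
      have : 0 ≤ K * (2 * R₁) := by positivity
      exact mul_le_mul_of_nonneg_right (by linarith) (by positivity)
    refine le_trans (norm_centroid_le (by positivity) fun k => ?_) h1
    refine (norm_localDirection_sub_le hG hμ0 hμ1 active sample W T k (centroid W)).trans ?_
    rw [hR₂, mul_assoc _ (1 + R₁)]
    refine mul_le_mul_of_nonneg_left ?_ (by positivity)
    have h2 := mul_le_mul_of_nonneg_left (mul_le_mul_of_nonneg_left (hWZ k) hR₁0) hμ0
    have h3 : 0 ≤ R₁ * D := by positivity
    have h4 : 0 ≤ μ * Z := by positivity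
    nlinarith [hdev k]
  · have h1 : familyNorm (deviation (localIterate G μ active sample W T))
        ≤ D + μ * ((R₁ + R₂ + K * (2 * R₁)) * Z) := by
      have h2 : deviation (localIterate G μ active sample W T)
          = fun k => deviation W k - μ • (γ k - centroid γ) := by
        funext k
        rw [hloc, deviation, centroid_sub_smul, deviation, smul_sub]
        abel
      have h3 : familyNorm (fun k => γ k - centroid γ) ≤ K * (2 * R₁ * Z) := by
        have := familyNorm_le_of_forall_le (v := fun k => γ k - centroid γ)
          (a := 2 * R₁ * Z) (by positivity)
          fun k => (norm_sub_le _ _).trans (by linarith [hγZ k])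
        simpa using this
      rw [h2]
      refine (familyNorm_sub_le _ _).trans ?_
      rw [← hD, familyNorm_smul, abs_of_nonneg hμ0]
      have h4 : 0 ≤ (R₁ + R₂) * Z := by positivity
      gcongr
      linarith
    rw [blockStep, deviation_mix hB]
    split_ifs with hact
    · rw [blockMatrix_of_forall_active hA hact]
      exact (hlam _ (sum_deviation _)).trans (mul_le_mul_of_nonneg_left h1 hlam0)
    · rw [one_mul]
      exact (familyNorm_mix_le_of_mem_doublyStochastic hB _).trans h1

end Block

/-! ### Scalar inequalities -/

section Scalar

lemma cube_mul_le {ε : ℝ} (hε : 0 < ε) {a b : ℝ} (ha : 0 ≤ a) (hb : 0 ≤ b) :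
    a ^ 3 * b ≤ ε * a ^ 4 + b ^ 4 / ε ^ 3 := by
  rcases le_total b (ε * a) with h | h
  · have h1 : a ^ 3 * b ≤ a ^ 3 * (ε * a) := by gcongr
    have h2 : 0 ≤ b ^ 4 / ε ^ 3 := by positivity
    nlinarith
  · have h1 : a ^ 3 * b ≤ b ^ 4 / ε ^ 3 := by
      rw [le_div_iff₀ (by positivity)]
      calc a ^ 3 * b * ε ^ 3 = (ε * a) ^ 3 * b := by ring
        _ ≤ b ^ 3 * b := by gcongr
        _ = b ^ 4 := by ring
    have h2 : 0 ≤ ε * a ^ 4 := by positivity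
    linarith

lemma add_pow_four_le {η : ℝ} (hη : 0 < η) {a b : ℝ} (ha : 0 ≤ a) (hb : 0 ≤ b) :
    (a + b) ^ 4 ≤ (1 + η) ^ 4 * a ^ 4 + (1 + 1 / η) ^ 4 * b ^ 4 := by
  rcases le_total b (η * a) with h | h
  · have h1 : (a + b) ^ 4 ≤ ((1 + η) * a) ^ 4 := by gcongr; linarith
    rw [mul_pow] at h1
    have h2 : 0 ≤ (1 + 1 / η) ^ 4 * b ^ 4 := by positivity
    linarith
  · have h0 : a ≤ 1 / η * b := by
      rw [one_div, ← div_eq_inv_mul, le_div_iff₀ hη]; linarith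
    have h1 : (a + b) ^ 4 ≤ ((1 + 1 / η) * b) ^ 4 := by gcongr; linarith
    rw [mul_pow] at h1
    have h2 : 0 ≤ (1 + η) ^ 4 * a ^ 4 := by positivity
    linarith

lemma exists_mul_one_add_pow_four_le {ρ : ℝ} (hρ : ρ < 1) :
    ∃ η, 0 < η ∧ ρ * (1 + η) ^ 4 ≤ (1 + ρ) / 2 := by
  have h1 : Tendsto (fun η : ℝ => ρ * (1 + η) ^ 4) (nhdsWithin 0 (Set.Ioi 0))
      (nhds (ρ * (1 + 0) ^ 4)) :=
    ((continuous_const.mul ((continuous_const.add continuous_id).pow 4)).tendsto 0).mono_left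
      nhdsWithin_le_nhds
  obtain ⟨η, h2, h3⟩ := ((h1.eventually_lt_const (by linarith : ρ * (1 + 0) ^ 4 < (1 + ρ) / 2)).and
    self_mem_nhdsWithin).exists
  exact ⟨η, h3, h2.le⟩

/-- The fourth power of the centroid error after a step: all that matters to leading order is the
inner product with the direction. -/
lemma norm_sub_smul_pow_four_le {E : Type*} [NormedAddCommGroup E] [InnerProductSpace ℝ E]
    (c g h : E) {μ b r : ℝ} (hμ : 0 ≤ μ) (hb : ‖g‖ ≤ b) (hr : ‖g - h‖ ≤ r) :
    ‖c - μ • g‖ ^ 4 ≤ ‖c‖ ^ 4 - 4 * μ * ‖c‖ ^ 2 * inner ℝ h c + 4 * μ * ‖c‖ ^ 3 * r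
      + 10 * μ ^ 2 * ‖c‖ ^ 2 * b ^ 2 + 2 * μ ^ 4 * b ^ 4 := by
  have h1 : ‖c - μ • g‖ ^ 2 = ‖c‖ ^ 2 - 2 * μ * inner ℝ g c + μ ^ 2 * ‖g‖ ^ 2 := by
    rw [norm_sub_sq_real, inner_smul_right, norm_smul, mul_pow, Real.norm_eq_abs, sq_abs,
      real_inner_comm]
    ring
  have h2 : inner ℝ g c ^ 2 ≤ ‖g‖ ^ 2 * ‖c‖ ^ 2 := by
    rw [← mul_pow, sq_le_sq, abs_of_nonneg (by positivity : 0 ≤ ‖g‖ * ‖c‖)]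
    exact abs_real_inner_le_norm g c
  have h3 : inner ℝ h c - inner ℝ g c ≤ r * ‖c‖ := by
    have h4 := real_inner_le_norm (h - g) c
    rw [inner_sub_left, norm_sub_rev] at h4
    exact h4.trans (by gcongr)
  have h5 : ‖c - μ • g‖ ^ 4 ≤ ‖c‖ ^ 4 - 4 * μ * ‖c‖ ^ 2 * inner ℝ g c
      + 10 * μ ^ 2 * ‖c‖ ^ 2 * ‖g‖ ^ 2 + 2 * μ ^ 4 * ‖g‖ ^ 4 := by
    have h6 : ‖c - μ • g‖ ^ 4 = (‖c - μ • g‖ ^ 2) ^ 2 := by ring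
    rw [h6, h1]
    have h7 := mul_le_mul_of_nonneg_left h2 (by positivity : 0 ≤ 8 * μ ^ 2)
    nlinarith [sq_nonneg (2 * μ * inner ℝ g c + μ ^ 2 * ‖g‖ ^ 2)]
  have h8 := mul_le_mul_of_nonneg_left h3 (by positivity : 0 ≤ 4 * μ * ‖c‖ ^ 2)
  have h9 : 10 * μ ^ 2 * ‖c‖ ^ 2 * ‖g‖ ^ 2 ≤ 10 * μ ^ 2 * ‖c‖ ^ 2 * b ^ 2 := by gcongr
  have h10 : 2 * μ ^ 4 * ‖g‖ ^ 4 ≤ 2 * μ ^ 4 * b ^ 4 := by gcongr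
  nlinarith

lemma sq_mul_le {ε : ℝ} (hε : 0 < ε) (a b : ℝ) : a ^ 2 * b ≤ ε * a ^ 4 + b ^ 2 / ε := by
  have h : 0 ≤ (2 * ε * a ^ 2 - b) ^ 2 / (4 * ε) := by positivity
  have h' : (2 * ε * a ^ 2 - b) ^ 2 / (4 * ε) = ε * a ^ 4 - a ^ 2 * b + b ^ 2 / ε / 4 := by
    field_simp; ring
  have h'' : 0 ≤ b ^ 2 / ε := by positivity
  linarith

lemma sq_mul_sq_le (a b : ℝ) : a ^ 2 * b ^ 2 ≤ a ^ 4 + b ^ 4 := by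
  nlinarith [sq_nonneg (a ^ 2 - b ^ 2), sq_nonneg (a ^ 2), sq_nonneg (b ^ 2)]

lemma one_add_add_sq_le (a b : ℝ) : (1 + a + b) ^ 2 ≤ 3 * (1 + a ^ 2 + b ^ 2) := by
  nlinarith [sq_nonneg (1 - a), sq_nonneg (1 - b), sq_nonneg (a - b)]

lemma one_add_add_pow_four_le (a b : ℝ) : (1 + a + b) ^ 4 ≤ 27 * (1 + (a ^ 4 + b ^ 4)) := by
  calc (1 + a + b) ^ 4 = ((1 + a + b) ^ 2) ^ 2 := by ring
    _ ≤ (3 * (1 + a ^ 2 + b ^ 2)) ^ 2 := by gcongr; exact one_add_add_sq_le a b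
    _ ≤ 27 * (1 + (a ^ 4 + b ^ 4)) := by
      nlinarith [sq_nonneg (1 - a ^ 2), sq_nonneg (1 - b ^ 2), sq_nonneg (a ^ 2 - b ^ 2)]

/-- The Lyapunov estimate. The bound for one block in terms of centroid error `c` and disagreement
`D` contracts `c ^ 4 + D ^ 4` by `1 - b μ` up to `O(μ ^ 3)`: every mixed term is split by Young's
inequality into a small multiple of `μ c ^ 4`, a term `O(μ) D ^ 4` that the contraction of the
disagreement absorbs, and `O(μ ^ 3)`. -/
lemma exists_lyapunov_bound {α R ρ : ℝ} (hα : 0 < α) (hR : 0 ≤ R) (hρ0 : 0 ≤ ρ) (hρ1 : ρ < 1) :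
    ∃ μ₀ b C, 0 < μ₀ ∧ μ₀ ≤ 1 ∧ 0 < b ∧ b * μ₀ ≤ 1 ∧ 0 ≤ C ∧ ∀ μ, 0 < μ → μ < μ₀ →
      ∀ c D Z : ℝ, 0 ≤ c → 0 ≤ D → Z = 1 + c + D →
      c ^ 4 - α * μ * c ^ 4 + 4 * μ * c ^ 3 * (R * (D + μ * Z))
        + 10 * μ ^ 2 * c ^ 2 * (R * Z) ^ 2 + 2 * μ ^ 4 * (R * Z) ^ 4
        + ρ * (D + μ * (R * Z)) ^ 4 ≤ (1 - b * μ) * (c ^ 4 + D ^ 4) + C * μ ^ 3 := by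
  -- `η` keeps the contraction factor of the disagreement below one, `ε` the total coefficient of
  -- `μ c ^ 4` from Young's inequality below `α / 2`
  obtain ⟨η, hη, hη'⟩ := exists_mul_one_add_pow_four_le hρ1
  obtain ⟨ε, hε, hε'⟩ : ∃ ε, 0 < ε ∧ ε * (8 * R + 30 * R ^ 2) ≤ α / 2 := by
    refine ⟨α / 2 / (8 * R + 30 * R ^ 2 + 1), by positivity, ?_⟩
    rw [div_mul_eq_mul_div, div_le_iff₀ (by positivity)]
    nlinarith
  set E₁ := 54 * R ^ 4 + 27 * R ^ 4 * (1 + 1 / η) ^ 4 with hE₁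
  have hE₁0 : 0 ≤ E₁ := by positivity
  set F := 4 * R / ε ^ 3 with hF
  have hF0 : 0 ≤ F := by positivity
  set C₀ := F + (8 * R + 60 * R ^ 2) + E₁ with hC₀
  have hC₀0 : 0 ≤ C₀ := by positivity
  set S := 30 * R ^ 2 / ε with hS
  have hS0 : 0 ≤ S := by positivity
  refine ⟨min 1 (min (α / 4 / (C₀ + 1)) ((1 - ρ) / 2 / (2 * C₀ + α / 4 + 1))), α / 4, C₀ + S,
    ?_, min_le_left _ _, by positivity, ?_, by positivity, ?_⟩
  · have : 0 < 1 - ρ := by linarith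
    positivity
  · have h1 : min 1 (min (α / 4 / (C₀ + 1)) ((1 - ρ) / 2 / (2 * C₀ + α / 4 + 1)))
        ≤ 1 / (2 * C₀ + α / 4 + 1) := by
      refine (min_le_right _ _).trans ((min_le_right _ _).trans ?_)
      gcongr
      linarith
    calc _ ≤ α / 4 * (1 / (2 * C₀ + α / 4 + 1)) := by gcongr
      _ ≤ 1 := by
        rw [mul_one_div, div_le_one (by positivity)]
        linarith
  intro μ hμ0 hμ c D Z hc hD hZ
  have hμ1 : μ ≤ 1 := (hμ.trans_le (min_le_left _ _)).le
  have hμ2 : C₀ * μ ≤ α / 4 := by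
    have h1 : μ < α / 4 / (C₀ + 1) :=
      hμ.trans_le ((min_le_right _ _).trans (min_le_left _ _))
    rw [lt_div_iff₀ (by positivity)] at h1
    nlinarith
  have hμ3 : (2 * C₀ + α / 4) * μ ≤ (1 - ρ) / 2 := by
    have h1 : μ < (1 - ρ) / 2 / (2 * C₀ + α / 4 + 1) :=
      hμ.trans_le ((min_le_right _ _).trans (min_le_right _ _))
    rw [lt_div_iff₀ (by positivity)] at h1
    nlinarith
  have hZ0 : 0 ≤ Z := by linarith
  set Y := c ^ 4 + D ^ 4 with hY
  have hY0 : 0 ≤ Y := by positivity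
  have hZ2 : Z ^ 2 ≤ 3 * (1 + c ^ 2 + D ^ 2) := hZ ▸ one_add_add_sq_le c D
  have hZ4 : Z ^ 4 ≤ 27 * (1 + Y) := hZ ▸ one_add_add_pow_four_le c D
  have hcD2 : c ^ 2 * D ^ 2 ≤ Y := sq_mul_sq_le c D
  have hcD3 : c ^ 3 * D ≤ Y := by simpa [hY] using cube_mul_le one_pos hc hD
  -- the five terms of the block bound, split by Young's inequality
  have tA : 4 * μ * c ^ 3 * (R * D) ≤ 4 * R * ε * (μ * c ^ 4) + F * (μ * D ^ 4) := by
    have := mul_le_mul_of_nonneg_left (cube_mul_le hε hc hD) (by positivity : 0 ≤ 4 * R * μ)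
    calc _ = 4 * R * μ * (c ^ 3 * D) := by ring
      _ ≤ _ := this
      _ = _ := by rw [hF]; ring
  have tB : 4 * μ * c ^ 3 * (R * (μ * Z))
      ≤ 4 * R * ε * (μ * c ^ 4) + F * μ ^ 5 + 8 * R * (μ ^ 2 * Y) := by
    have h1 := mul_le_mul_of_nonneg_left (cube_mul_le hε hc hμ0.le)
      (by positivity : 0 ≤ 4 * R * μ)
    have h2 : c ^ 4 + c ^ 3 * D ≤ 2 * Y := by
      have : 0 ≤ D ^ 4 := by positivity
      linarith
    have h3 := mul_le_mul_of_nonneg_left h2 (by positivity : 0 ≤ 4 * R * μ ^ 2)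
    calc _ = 4 * R * μ * (c ^ 3 * μ) + 4 * R * μ ^ 2 * (c ^ 4 + c ^ 3 * D) := by rw [hZ]; ring
      _ ≤ _ := add_le_add h1 h3
      _ = _ := by rw [hF]; ring
  have tC : 10 * μ ^ 2 * c ^ 2 * (R * Z) ^ 2
      ≤ 30 * R ^ 2 * ε * (μ * c ^ 4) + S * μ ^ 3 + 60 * R ^ 2 * (μ ^ 2 * Y) := by
    have h1 := sq_mul_le hε c μ
    have h1' := mul_le_mul_of_nonneg_left h1 (by positivity : 0 ≤ 30 * R ^ 2 * μ)
    have h2 : c ^ 4 + c ^ 2 * D ^ 2 ≤ 2 * Y := by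
      have : 0 ≤ D ^ 4 := by positivity
      linarith
    have h3 := mul_le_mul_of_nonneg_left h2 (by positivity : 0 ≤ 30 * R ^ 2 * μ ^ 2)
    calc _ = 10 * μ ^ 2 * c ^ 2 * R ^ 2 * Z ^ 2 := by ring
      _ ≤ 10 * μ ^ 2 * c ^ 2 * R ^ 2 * (3 * (1 + c ^ 2 + D ^ 2)) := by gcongr
      _ = 30 * R ^ 2 * μ * (c ^ 2 * μ) + 30 * R ^ 2 * μ ^ 2 * (c ^ 4 + c ^ 2 * D ^ 2) := by ring
      _ ≤ _ := add_le_add h1' h3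
      _ = _ := by rw [hS]; ring
  have tD : 2 * μ ^ 4 * (R * Z) ^ 4 ≤ 54 * R ^ 4 * (μ ^ 4 * (1 + Y)) := by
    calc _ = 2 * μ ^ 4 * R ^ 4 * Z ^ 4 := by ring
      _ ≤ 2 * μ ^ 4 * R ^ 4 * (27 * (1 + Y)) := by gcongr
      _ = _ := by ring
  have tE : ρ * (D + μ * (R * Z)) ^ 4
      ≤ (1 + ρ) / 2 * D ^ 4 + 27 * R ^ 4 * (1 + 1 / η) ^ 4 * (μ ^ 4 * (1 + Y)) := by
    have h1 := mul_le_mul_of_nonneg_left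
      (add_pow_four_le hη hD (by positivity : 0 ≤ μ * (R * Z))) hρ0
    have h2 : ρ * ((1 + 1 / η) ^ 4 * (μ * (R * Z)) ^ 4)
        ≤ 27 * R ^ 4 * (1 + 1 / η) ^ 4 * (μ ^ 4 * (1 + Y)) := by
      calc _ ≤ 1 * ((1 + 1 / η) ^ 4 * (μ * (R * Z)) ^ 4) := by gcongr
        _ = (1 + 1 / η) ^ 4 * μ ^ 4 * R ^ 4 * Z ^ 4 := by ring
        _ ≤ (1 + 1 / η) ^ 4 * μ ^ 4 * R ^ 4 * (27 * (1 + Y)) := by gcongr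
        _ = _ := by ring
    have h3 := mul_le_mul_of_nonneg_right hη' (by positivity : 0 ≤ D ^ 4)
    rw [mul_add, ← mul_assoc] at h1
    linarith
  -- higher powers of `μ` are absorbed using `μ ≤ 1`
  have m5 : μ ^ 5 ≤ μ ^ 3 := pow_le_pow_of_le_one hμ0.le hμ1 (by norm_num)
  have m4 : μ ^ 4 ≤ μ ^ 3 := pow_le_pow_of_le_one hμ0.le hμ1 (by norm_num)
  have m42 : μ ^ 4 ≤ μ ^ 2 := pow_le_pow_of_le_one hμ0.le hμ1 (by norm_num)
  have tDE : E₁ * (μ ^ 4 * (1 + Y)) ≤ E₁ * μ ^ 3 + E₁ * (μ ^ 2 * Y) := by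
    have h1 := mul_le_mul_of_nonneg_left m4 hE₁0
    have h2 := mul_le_mul_of_nonneg_left (mul_le_mul_of_nonneg_right m42 hY0) hE₁0
    rw [mul_add (μ ^ 4), mul_one, mul_add]
    linarith
  have tF : F * μ ^ 5 ≤ F * μ ^ 3 := by gcongr
  have tF' : F * (μ * D ^ 4) ≤ C₀ * (μ * D ^ 4) := by
    have : F ≤ C₀ := by
      have : 0 ≤ 8 * R + 60 * R ^ 2 := by positivity
      linarith
    gcongr
  have tY : (8 * R + 60 * R ^ 2 + E₁) * (μ ^ 2 * Y) ≤ C₀ * (μ ^ 2 * Y) := by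
    have : 8 * R + 60 * R ^ 2 + E₁ ≤ C₀ := by linarith
    gcongr
  have t3 : (F + S + E₁) * μ ^ 3 ≤ (C₀ + S) * μ ^ 3 := by
    have : 0 ≤ 8 * R + 60 * R ^ 2 := by positivity
    exact mul_le_mul_of_nonneg_right (by linarith) (by positivity)
  have tc : (8 * R + 30 * R ^ 2) * ε * (μ * c ^ 4) ≤ α / 2 * (μ * c ^ 4) := by
    gcongr
    linarith
  -- smallness of `μ` absorbs the remainders into the coefficients of `c ^ 4` and of `D ^ 4`
  have fc : C₀ * μ ^ 2 * c ^ 4 ≤ α / 4 * μ * c ^ 4 := by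
    have h : C₀ * μ ^ 2 ≤ α / 4 * μ := by
      rw [sq, ← mul_assoc]
      exact mul_le_mul_of_nonneg_right hμ2 hμ0.le
    gcongr
  have fD : (C₀ * μ + C₀ * μ ^ 2 + α / 4 * μ) * D ^ 4 ≤ (1 - ρ) / 2 * D ^ 4 := by
    have h : C₀ * μ + C₀ * μ ^ 2 + α / 4 * μ ≤ (1 - ρ) / 2 := by
      have : C₀ * μ ^ 2 ≤ C₀ * μ :=
        mul_le_mul_of_nonneg_left (pow_le_of_le_one hμ0.le hμ1 two_ne_zero) hC₀0
      linarith
    gcongr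
  have expand : 4 * μ * c ^ 3 * (R * (D + μ * Z))
      = 4 * μ * c ^ 3 * (R * D) + 4 * μ * c ^ 3 * (R * (μ * Z)) := by ring
  rw [expand]
  have tE₁ : 54 * R ^ 4 * (μ ^ 4 * (1 + Y)) + 27 * R ^ 4 * (1 + 1 / η) ^ 4 * (μ ^ 4 * (1 + Y))
      = E₁ * (μ ^ 4 * (1 + Y)) := by rw [hE₁]; ring
  have total : c ^ 4 - α * μ * c ^ 4 + (4 * μ * c ^ 3 * (R * D) + 4 * μ * c ^ 3 * (R * (μ * Z)))
        + 10 * μ ^ 2 * c ^ 2 * (R * Z) ^ 2 + 2 * μ ^ 4 * (R * Z) ^ 4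
        + ρ * (D + μ * (R * Z)) ^ 4
      ≤ c ^ 4 - α * μ * c ^ 4 + (8 * R + 30 * R ^ 2) * ε * (μ * c ^ 4) + F * (μ * D ^ 4)
        + (8 * R + 60 * R ^ 2 + E₁) * (μ ^ 2 * Y) + (F + S + E₁) * μ ^ 3
        + (1 + ρ) / 2 * D ^ 4 := by
    linarith
  have expY : C₀ * (μ ^ 2 * Y) = C₀ * μ ^ 2 * c ^ 4 + C₀ * μ ^ 2 * D ^ 4 := by rw [hY]; ring
  have expR : (1 - α / 4 * μ) * Y
      = c ^ 4 + D ^ 4 - α / 4 * μ * c ^ 4 - α / 4 * μ * D ^ 4 := by rw [hY]; ring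
  rw [expR]
  have expF : C₀ * (μ * D ^ 4) = C₀ * μ * D ^ 4 := by ring
  rw [add_mul, add_mul] at fD
  linarith

end Scalar

/-! ### Expected contraction over one block -/

section Expected

variable {K M : ℕ} {N : Fin K → ℕ} {G : ∀ k, Fin (N k) → Model M → Model M} {L : ℝ}
  {wo : Model M}

/-- The Lyapunov function: fourth powers of the centroid error and of the disagreement. -/
def lyapunov (wo : Model M) (W : Fin K → Model M) : ℝ :=
  ‖centroid W - wo‖ ^ 4 + familyNorm (deviation W) ^ 4

lemma lyapunov_nonneg (wo : Model M) (W : Fin K → Model M) : 0 ≤ lyapunov wo W := by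
  have := familyNorm_nonneg (deviation W)
  unfold lyapunov
  positivity

lemma norm_sub_pow_four_le_lyapunov (wo : Model M) (W : Fin K → Model M) (k : Fin K) :
    ‖wo - W k‖ ^ 4 ≤ 8 * lyapunov wo W := by
  have h1 : ‖wo - W k‖ ≤ ‖centroid W - wo‖ + familyNorm (deviation W) := by
    rw [norm_sub_rev, ← sub_add_sub_cancel (W k) (centroid W) wo, add_comm]
    exact (norm_add_le _ _).trans (add_le_add le_rfl (norm_le_familyNorm (deviation W) k))
  have h2 := familyNorm_nonneg (deviation W)
  calc ‖wo - W k‖ ^ 4 ≤ (‖centroid W - wo‖ + familyNorm (deviation W)) ^ 4 := by gcongr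
    _ ≤ 2 ^ 3 * (‖centroid W - wo‖ ^ 4 + familyNorm (deviation W) ^ 4) :=
        add_pow_le (norm_nonneg _) h2 4
    _ = _ := by rw [lyapunov]; norm_num

/-- The features of the law of the randomness of one block that the analysis uses, for a law given
by weights on a finite type: the joint law of activation and sample of one agent at one time, and
the probability that all agents are active. -/
structure IsBlockLaw {Ξ : Type} [Fintype Ξ] (q : Fin K → ℝ) (T : ℕ) (p : Ξ → ℝ)
    (active : Ξ → Fin K → Bool) (sample : Ξ → ℕ → ∀ k, Fin (N k)) : Prop where
  nonneg : ∀ ξ, 0 ≤ p ξ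
  sum_eq_one : ∑ ξ, p ξ = 1
  active_sample : ∀ k, ∀ t < T, ∀ n,
    ∑ ξ, (if active ξ k = true ∧ sample ξ t k = n then p ξ else 0) = q k / N k
  all_active : ∑ ξ, (if ∀ k, active ξ k = true then p ξ else 0) = ∏ k, q k

lemma IsBlockLaw.sum_smul_meanDirection {Ξ : Type} [Fintype Ξ] {q : Fin K → ℝ} {T : ℕ} {p : Ξ → ℝ}
    {active : Ξ → Fin K → Bool} {sample : Ξ → ℕ → ∀ k, Fin (N k)}
    (h : IsBlockLaw q T p active sample) (G : ∀ k, Fin (N k) → Model M → Model M) (z : Model M) :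
    ∑ ξ, p ξ • meanDirection G T (active ξ) (sample ξ) z
      = (T / K : ℝ) • ∑ k, (q k / N k) • ∑ n, G k n z := by
  have h1 : ∀ k, ∀ t < T, ∑ ξ, p ξ • (if active ξ k = true then G k (sample ξ t k) z else 0)
      = (q k / N k) • ∑ n, G k n z := by
    intro k t ht
    calc ∑ ξ, p ξ • (if active ξ k = true then G k (sample ξ t k) z else 0)
        = ∑ ξ, ∑ n, (if active ξ k = true ∧ sample ξ t k = n then p ξ else 0) • G k n z := by
          refine Finset.sum_congr rfl fun ξ _ => ?_
          cases active ξ k <;> simp [ite_smul]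
      _ = ∑ n, (q k / N k) • G k n z := by
          rw [Finset.sum_comm]
          refine Finset.sum_congr rfl fun n _ => ?_
          rw [← Finset.sum_smul, h.active_sample k t ht n]
      _ = _ := by rw [Finset.smul_sum]
  have h2 : ∀ ξ, p ξ • meanDirection G T (active ξ) (sample ξ) z = (1 / K : ℝ) •
      ∑ k, ∑ t ∈ Finset.range T, p ξ • (if active ξ k = true then G k (sample ξ t k) z else 0) := by
    intro ξ
    rw [meanDirection, centroid, smul_comm]
    simp only [Finset.smul_sum]
  have h3 : ∀ k, ∑ ξ, ∑ t ∈ Finset.range T,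
      p ξ • (if active ξ k = true then G k (sample ξ t k) z else 0)
        = (T : ℝ) • ((q k / N k) • ∑ n, G k n z) := by
    intro k
    rw [Finset.sum_comm, Finset.sum_congr rfl fun t ht => h1 k t (Finset.mem_range.1 ht),
      Finset.sum_const, Finset.card_range, Nat.cast_smul_eq_nsmul]
  simp only [h2]
  rw [← Finset.smul_sum, Finset.sum_comm]
  simp only [h3]
  rw [← Finset.smul_sum, smul_smul, one_div_mul_eq_div]

/-- Over one block the Lyapunov function contracts in mean by the factor `1 - b μ`, up to
`O(μ ^ 3)`. -/
lemma exists_expected_lyapunov_le {A : Matrix (Fin K) (Fin K) ℝ} (hA : IsCombinationMatrix A)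
    (hK : 0 < K) (hG : IsLipschitzOracle G wo L) {T : ℕ} (hT : 0 < T) {q : Fin K → ℝ}
    (hq : ∀ k, 0 < q k ∧ q k ≤ 1) {a : ℝ} (ha : 0 < a)
    (hmono : ∀ w, a * ‖w - wo‖ ^ 2 ≤ inner ℝ (∑ k, (q k / N k) • ∑ n, G k n w) (w - wo)) :
    ∃ μ₀ b C, 0 < μ₀ ∧ 0 < b ∧ b * μ₀ ≤ 1 ∧ 0 ≤ C ∧
      ∀ (Ξ : Type) [Fintype Ξ] (p : Ξ → ℝ) (active : Ξ → Fin K → Bool)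
        (sample : Ξ → ℕ → ∀ k, Fin (N k)), IsBlockLaw q T p active sample →
      ∀ μ, 0 < μ → μ < μ₀ → ∀ W : Fin K → Model M,
        ∑ ξ, p ξ * lyapunov wo (blockStep A G T μ (active ξ) (sample ξ) W)
          ≤ (1 - b * μ) * lyapunov wo W + C * μ ^ 3 := by
  have : Nonempty (Fin K) := ⟨⟨0, hK⟩⟩
  have hK' : (0 : ℝ) < K := by exact_mod_cast hK
  have hT' : (0 : ℝ) < T := by exact_mod_cast hT
  obtain ⟨lam, hlam0, hlam1, hlam⟩ := exists_contractsZeroSum_of_isPrimitive (E := Model M)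
    hA.isSymm hA.mem_doublyStochastic hA.primitive
  obtain ⟨R, hR0, hR⟩ := exists_blockStep_bounds hA hlam0 hlam hG T
  have hπ0 : 0 < ∏ k, q k := Finset.prod_pos fun k _ => (hq k).1
  have hπ1 : ∏ k, q k ≤ 1 := Finset.prod_le_one (fun k _ => (hq k).1.le) fun k _ => (hq k).2
  have hlam4 : lam ^ 4 < 1 := pow_lt_one₀ hlam0 hlam1 (by norm_num)
  set ρ := 1 - (∏ k, q k) * (1 - lam ^ 4) with hρ
  have hlam40 : 0 ≤ lam ^ 4 := by positivity
  obtain ⟨μ₀, b, C, hμ₀, hμ₀1, hb, hbμ, hC, hmain⟩ := exists_lyapunov_bound (α := 4 * (T / K * a))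
    (R := R) (ρ := ρ) (by positivity) hR0 (by nlinarith) (by nlinarith)
  refine ⟨μ₀, b, C, hμ₀, hb, hbμ, hC, ?_⟩
  intro Ξ _ p active sample hp μ hμ0 hμ W
  set c := centroid W - wo with hc
  set D := familyNorm (deviation W) with hD
  have hD0 : 0 ≤ D := familyNorm_nonneg _
  set Z := 1 + ‖c‖ + D with hZ
  have hZ0 : 0 ≤ Z := by positivity
  set h := fun ξ => meanDirection G T (active ξ) (sample ξ) (centroid W) with hh
  set B := R * Z with hB
  have hB0 : 0 ≤ B := by positivity
  have hpoint : ∀ ξ, lyapunov wo (blockStep A G T μ (active ξ) (sample ξ) W)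
      ≤ (‖c‖ ^ 4 - 4 * μ * ‖c‖ ^ 2 * inner ℝ (h ξ) c + 4 * μ * ‖c‖ ^ 3 * (R * (D + μ * Z))
        + 10 * μ ^ 2 * ‖c‖ ^ 2 * B ^ 2 + 2 * μ ^ 4 * B ^ 4)
        + (1 - (if ∀ k, active ξ k = true then 1 else 0) * (1 - lam ^ 4)) * (D + μ * B) ^ 4 := by
    intro ξ
    obtain ⟨⟨g, hg, hgZ, hgr⟩, hdev⟩ := hR μ hμ0.le (hμ.le.trans hμ₀1) (active ξ) (sample ξ) W
      ‖c‖ D Z rfl rfl rfl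
    refine add_le_add ?_ ?_
    · rw [hg, sub_right_comm]
      exact norm_sub_smul_pow_four_le c g (h ξ) hμ0.le hgZ hgr
    · refine (pow_le_pow_left₀ (familyNorm_nonneg _) hdev 4).trans (le_of_eq ?_)
      rw [mul_pow]
      split_ifs <;> ring
  have hdrift : T / K * a * ‖c‖ ^ 2 ≤ ∑ ξ, p ξ * inner ℝ (h ξ) c := by
    have h1 : ∑ ξ, p ξ * inner ℝ (h ξ) c = inner ℝ (∑ ξ, p ξ • h ξ) c := by
      simp [sum_inner, real_inner_smul_left]
    rw [h1, hh, hp.sum_smul_meanDirection, real_inner_smul_left, mul_assoc]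
    exact mul_le_mul_of_nonneg_left (hmono _) (by positivity)
  have hall : ∑ ξ, p ξ * (1 - (if ∀ k, active ξ k = true then 1 else 0) * (1 - lam ^ 4)) = ρ := by
    have h1 : ∀ ξ, p ξ * (1 - (if ∀ k, active ξ k = true then 1 else 0) * (1 - lam ^ 4))
        = p ξ - (if ∀ k, active ξ k = true then p ξ else 0) * (1 - lam ^ 4) := by
      intro ξ
      split_ifs <;> ring
    simp only [h1]
    rw [Finset.sum_sub_distrib, ← Finset.sum_mul, hp.all_active, hp.sum_eq_one]
  have hsum : ∑ ξ, p ξ * lyapunov wo (blockStep A G T μ (active ξ) (sample ξ) W)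
      ≤ ‖c‖ ^ 4 - 4 * μ * ‖c‖ ^ 2 * (∑ ξ, p ξ * inner ℝ (h ξ) c)
        + 4 * μ * ‖c‖ ^ 3 * (R * (D + μ * Z))
        + 10 * μ ^ 2 * ‖c‖ ^ 2 * B ^ 2 + 2 * μ ^ 4 * B ^ 4 + ρ * (D + μ * B) ^ 4 := by
    refine (Finset.sum_le_sum fun ξ _ =>
      mul_le_mul_of_nonneg_left (hpoint ξ) (hp.nonneg ξ)).trans (le_of_eq ?_)
    have h1 : ∀ (u w v₁ v₂ v₃ F : ℝ) (X Y : Ξ → ℝ),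
        ∑ ξ, p ξ * ((u - w * X ξ + v₁ + v₂ + v₃) + Y ξ * F)
          = u - w * (∑ ξ, p ξ * X ξ) + v₁ + v₂ + v₃ + (∑ ξ, p ξ * Y ξ) * F := by
      intro u w v₁ v₂ v₃ F X Y
      have h2 : ∀ ξ, p ξ * ((u - w * X ξ + v₁ + v₂ + v₃) + Y ξ * F)
          = (u + v₁ + v₂ + v₃) * p ξ - w * (p ξ * X ξ) + (p ξ * Y ξ) * F := fun ξ => by ring
      simp only [h2, Finset.sum_add_distrib, Finset.sum_sub_distrib, ← Finset.mul_sum,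
        ← Finset.sum_mul, hp.sum_eq_one]
      ring
    rw [h1, hall]
  refine hsum.trans (le_trans ?_ (hmain μ hμ0 hμ ‖c‖ D Z (norm_nonneg _) hD0 rfl))
  have h1 := mul_le_mul_of_nonneg_left hdrift (by positivity : 0 ≤ 4 * μ * ‖c‖ ^ 2)
  have h2 : 4 * (T / K * a) * μ * ‖c‖ ^ 4 = 4 * μ * ‖c‖ ^ 2 * (T / K * a * ‖c‖ ^ 2) := by ring
  rw [h2]
  linarith

end Expected

/-! ### The algorithm block by block -/

section Blocks

variable {K M : ℕ} {X : Type*} {N : Fin K → ℕ} {A : Matrix (Fin K) (Fin K) ℝ}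
  {Q : Fin K → Model M → X → ℝ} {x : ∀ k, Fin (N k) → X} {T : ℕ} {μ : ℝ}

lemma iterate_mul_add (active : ℕ → Fin K → Bool) (sample : ℕ → ∀ k, Fin (N k)) (i : ℕ) {t : ℕ}
    (ht : t < T) :
    iterate A Q x T μ active sample (i * T + t)
      = localIterate (lossGradient Q x) μ (active i) (fun t => sample (i * T + t % T + 1))
        (iterate A Q x T μ active sample (i * T)) t := by
  induction t with
  | zero => rfl
  | succ t ih =>
    have h1 : ¬ T ∣ i * T + t + 1 := by
      rw [add_assoc, Nat.dvd_add_right (Dvd.intro_left i rfl)]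
      exact Nat.not_dvd_of_pos_of_lt (Nat.succ_pos t) ht
    have h2 : (i * T + t) / T = i := by
      rw [mul_comm, Nat.mul_add_div (by omega), Nat.div_eq_of_lt (by omega), add_zero]
    funext k
    rw [← add_assoc, iterate, localIterate, ← ih (by omega), h2,
      Nat.mod_eq_of_lt (show t < T by omega)]
    simp [combinationAt, h1, Matrix.one_apply, lossGradient]

/-- The samples used during the block are `sample (i * T + 1), …, sample (i * T + T)`; the residue
modulo `T` does not matter for the times `t < T` and makes the step a function of finitely many
samples. -/
lemma iterate_succ_mul (hT : 0 < T) (active : ℕ → Fin K → Bool) (sample : ℕ → ∀ k, Fin (N k))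
    (i : ℕ) :
    iterate A Q x T μ active sample ((i + 1) * T)
      = blockStep A (lossGradient Q x) T μ (active i) (fun t => sample (i * T + t % T + 1))
        (iterate A Q x T μ active sample (i * T)) := by
  obtain ⟨S, rfl⟩ : ∃ S, T = S + 1 := ⟨T - 1, by omega⟩
  have h0 : (i + 1) * (S + 1) = i * (S + 1) + S + 1 := by ring
  have h1 : S + 1 ∣ i * (S + 1) + S + 1 := h0 ▸ Dvd.intro_left _ rfl
  have h2 : (i * (S + 1) + S) / (S + 1) = i := by
    rw [mul_comm, Nat.mul_add_div (by omega), Nat.div_eq_of_lt (by omega), add_zero]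
  funext k
  rw [h0, iterate, blockStep, mix, iterate_mul_add active sample i (Nat.lt_succ_self S), h2]
  simp only [combinationAt, h1, if_true, localIterate, Nat.mod_eq_of_lt (Nat.lt_succ_self S),
    lossGradient]

end Blocks

/-! ### Independence of past and block -/

section Randomness

variable {K M : ℕ} {X : Type*} {N : Fin K → ℕ} {A : Matrix (Fin K) (Fin K) ℝ}
  {Q : Fin K → Model M → X → ℝ} {x : ∀ k, Fin (N k) → X} {T : ℕ} {μ : ℝ}
  {q : Fin K → ℝ} {Ω : Type*}

lemma measurable_iterate [MeasurableSpace Ω] (hcont : ∀ k n, Continuous (lossGradient Q x k n))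
    {active : ℕ → Fin K → Ω → Bool} {sample : ℕ → ∀ k : Fin K, Ω → Fin (N k)} (n : ℕ)
    (hactive : ∀ j l, j * T < n → Measurable (active j l))
    (hsample : ∀ s l, s ≤ n → Measurable (sample s l)) :
    Measurable fun ω => iterate A Q x T μ (fun j l => active j l ω) (fun n l => sample n l ω) n := by
  induction n with
  | zero => exact measurable_const
  | succ n ih =>
    have ih' := ih (fun j l hj => hactive j l (by omega)) fun s l hs => hsample s l (by omega)
    have ha : Measurable fun ω l => active (n / T) l ω := measurable_pi_lambda _ fun l =>
      hactive _ l (Nat.lt_succ_of_le (Nat.div_mul_le_self n T))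
    refine measurable_pi_lambda _ fun k => ?_
    simp only [iterate]
    refine Finset.measurable_sum _ fun l _ => Measurable.fun_smul ?_
      (Measurable.fun_sub ?_ (Measurable.fun_smul ?_ ?_))
    · exact (measurable_of_finite fun a : Fin K → Bool => combinationAt A T a (n + 1) l k).comp ha
    · exact (measurable_pi_apply l).comp ih'
    · exact (measurable_of_finite fun a : Fin K → Bool => stepSize μ (a l)).comp ha
    · have h1 : Measurable fun p : Fin (N l) × Model M => lossGradient Q x l p.1 p.2 :=
        measurable_from_prod_countable_right fun n => (hcont l n).measurable
      exact h1.comp ((hsample _ l le_rfl).prodMk ((measurable_pi_apply l).comp ih'))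

/-- The values of the activations and of the samples of one block. -/
abbrev BlockOutcome (N : Fin K → ℕ) (T : ℕ) : Type :=
  (Fin K → Bool) × (Fin T → ∀ k, Fin (N k))

/-- The randomness of block `i`. -/
def blockOutcome (T : ℕ) (active : ℕ → Fin K → Ω → Bool)
    (sample : ℕ → ∀ k : Fin K, Ω → Fin (N k)) (i : ℕ) (ω : Ω) : BlockOutcome N T :=
  (fun k => active i k ω, fun t k => sample (i * T + t + 1) k ω)

/-- The samples in the outcome of a block, as a function of all times. -/
def BlockOutcome.sampleAt [NeZero T] (ξ : BlockOutcome N T) (t : ℕ) : ∀ k, Fin (N k) :=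
  ξ.2 (Fin.ofNat T t)

variable {active : ℕ → Fin K → Ω → Bool} {sample : ℕ → ∀ k : Fin K, Ω → Fin (N k)}

lemma measurable_blockOutcome [MeasurableSpace Ω] {i : ℕ}
    (hactive : ∀ k, Measurable (active i k))
    (hsample : ∀ s k, i * T < s → s ≤ i * T + T → Measurable (sample s k)) :
    Measurable (blockOutcome T active sample i) := by
  refine Measurable.prodMk (measurable_pi_lambda _ hactive)
    (measurable_pi_lambda _ fun t => measurable_pi_lambda _ fun k => hsample _ k ?_ ?_)
  · omega
  · have := t.2; omega

variable [MeasurableSpace Ω] {P : Measure Ω}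

lemma IsAlgorithmRandomness.measurable_blockOutcome (h : IsAlgorithmRandomness q P active sample)
    (i : ℕ) : Measurable (blockOutcome T active sample i) :=
  PartialDiffusion.measurable_blockOutcome (h.measurable_active i)
    fun s k _ _ => h.measurable_sample s k

lemma IsAlgorithmRandomness.sum_measureReal_eq [IsProbabilityMeasure P]
    (h : IsAlgorithmRandomness q P active sample) (i : ℕ) (p : BlockOutcome N T → Prop)
    [DecidablePred p] :
    ∑ ξ, (if p ξ then P.real (blockOutcome T active sample i ⁻¹' {ξ}) else 0)
      = P.real {ω | p (blockOutcome T active sample i ω)} := by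
  rw [← Finset.sum_filter, sum_measureReal_preimage_singleton _
    fun ξ _ => h.measurable_blockOutcome i (measurableSet_singleton ξ)]
  congr 1
  ext ω
  simp

lemma IsAlgorithmRandomness.isBlockLaw [NeZero T] [IsProbabilityMeasure P]
    (h : IsAlgorithmRandomness q P active sample) (hq : ∀ k, 0 < q k ∧ q k ≤ 1) (i : ℕ) :
    IsBlockLaw q T (fun ξ => P.real (blockOutcome T active sample i ⁻¹' {ξ}))
      (fun ξ : BlockOutcome N T => ξ.1) BlockOutcome.sampleAt := by
  have hmeas : ∀ k, MeasurableSet[MeasurableSpace.comap (active i k) ⊤] {ω | active i k ω = true} :=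
    fun k => ⟨{true}, trivial, rfl⟩
  refine ⟨fun ξ => measureReal_nonneg, ?_, fun k t ht n => ?_, ?_⟩
  · simpa using h.sum_measureReal_eq (T := T) i fun _ => True
  · rw [h.sum_measureReal_eq i fun ξ : BlockOutcome N T => ξ.1 k = true ∧ ξ.sampleAt t k = n]
    have h1 := h.indep.indep (i := Sum.inl (i, k)) (j := Sum.inr (i * T + t + 1, k)) (by simp)
    have h2 := (Indep_iff _ _ P).1 h1 {ω | active i k ω = true}
      {ω | sample (i * T + t + 1) k ω = n} (hmeas k) ⟨{n}, trivial, rfl⟩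
    rw [h.prob_active, h.prob_sample] at h2
    have h3 : {ω | (blockOutcome T active sample i ω).1 k = true
        ∧ (blockOutcome T active sample i ω).sampleAt t k = n}
        = {ω | active i k ω = true} ∩ {ω | sample (i * T + t + 1) k ω = n} := by
      ext ω
      simp [blockOutcome, BlockOutcome.sampleAt, Nat.mod_eq_of_lt ht]
    rw [h3, measureReal_def, h2, ENNReal.toReal_mul, ENNReal.toReal_ofReal (hq k).1.le,
      ENNReal.toReal_inv, ENNReal.toReal_natCast, div_eq_mul_inv]
  · rw [h.sum_measureReal_eq i fun ξ : BlockOutcome N T => ∀ k, ξ.1 k = true]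
    have h1 := (h.indep.precomp (g := fun k : Fin K => Sum.inl (i, k))
      fun k l hkl => by simpa using hkl).meas_iInter hmeas
    have h2 : {ω | ∀ k, (blockOutcome T active sample i ω).1 k = true}
        = ⋂ k, {ω | active i k ω = true} := by
      ext ω
      simp [blockOutcome]
    rw [h2, measureReal_def, h1, ENNReal.toReal_prod]
    exact Finset.prod_congr rfl fun k _ => by
      rw [h.prob_active, ENNReal.toReal_ofReal (hq k).1.le]

/-- The models at the beginning of a block are independent of the randomness of the block. -/
lemma IsAlgorithmRandomness.indepFun_iterate (h : IsAlgorithmRandomness q P active sample)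
    (hcont : ∀ k n, Continuous (lossGradient Q x k n)) (i : ℕ) :
    IndepFun (fun ω => iterate A Q x T μ (fun j l => active j l ω) (fun n l => sample n l ω)
      (i * T)) (blockOutcome T active sample i) P := by
  set fam : (ℕ × Fin K) ⊕ (ℕ × Fin K) → MeasurableSpace Ω := Sum.elim
      (fun p : ℕ × Fin K => MeasurableSpace.comap (active p.1 p.2) ⊤)
      (fun p : ℕ × Fin K => MeasurableSpace.comap (sample p.1 p.2) ⊤) with hfam
  have hle : ∀ s, fam s ≤ (inferInstance : MeasurableSpace Ω) := by
    rintro (p | p)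
    · exact (h.measurable_active p.1 p.2).comap_le
    · exact (h.measurable_sample p.1 p.2).comap_le
  set past : Set ((ℕ × Fin K) ⊕ (ℕ × Fin K)) :=
    {s | Sum.elim (fun p => p.1 * T < i * T) (fun p => p.1 ≤ i * T) s} with hpast
  set block : Set ((ℕ × Fin K) ⊕ (ℕ × Fin K)) :=
    {s | Sum.elim (fun p => p.1 = i) (fun p => i * T < p.1) s} with hblock
  have hdisj : Disjoint past block := by
    rw [Set.disjoint_left]
    rintro (⟨j, k⟩ | ⟨n, k⟩) h1 h2
    · have h1' : j * T < i * T := h1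
      have h2' : j = i := h2
      simp [h2'] at h1'
    · exact absurd (show n ≤ i * T from h1) (not_le.2 h2)
  have hindep := indep_iSup_of_disjoint hle h.indep hdisj
  have hact : ∀ (S : Set ((ℕ × Fin K) ⊕ (ℕ × Fin K))) j l, Sum.inl (j, l) ∈ S →
      Measurable[⨆ s ∈ S, fam s] (active j l) := fun S j l hS =>
    measurable_iff_comap_le.2 (le_iSup₂_of_le (f := fun s (_ : s ∈ S) => fam s) _ hS le_rfl)
  have hsmp : ∀ (S : Set ((ℕ × Fin K) ⊕ (ℕ × Fin K))) n l, Sum.inr (n, l) ∈ S →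
      Measurable[⨆ s ∈ S, fam s] (sample n l) := fun S n l hS =>
    measurable_iff_comap_le.2 (le_iSup₂_of_le (f := fun s (_ : s ∈ S) => fam s) _ hS le_rfl)
  refine indep_of_indep_of_le_left (indep_of_indep_of_le_right hindep ?_) ?_
  · exact (@PartialDiffusion.measurable_blockOutcome _ _ T Ω _ _ (⨆ s ∈ block, fam s) i (fun k => hact block i k rfl)
      fun s k hs _ => hsmp block s k hs).comap_le
  · exact (@measurable_iterate _ _ _ _ A Q x T μ Ω (⨆ s ∈ past, fam s) hcont _ _ (i * T)
      (fun j l hj => hact past j l hj) fun s l hs => hsmp past s l hs).comap_le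

end Randomness

/-! ### The Lyapunov recursion -/

section Recursion

variable {K M : ℕ} {X : Type*} {N : Fin K → ℕ} {A : Matrix (Fin K) (Fin K) ℝ}
  {Q : Fin K → Model M → X → ℝ} {x : ∀ k, Fin (N k) → X} {T : ℕ} {μ : ℝ}
  {q : Fin K → ℝ} {Ω : Type*} {wo : Model M}

lemma IsLipschitzOracle.continuous {G : ∀ k, Fin (N k) → Model M → Model M} {L : ℝ}
    (hG : IsLipschitzOracle G wo L) (k : Fin K) (n : Fin (N k)) : Continuous (G k n) :=
  (LipschitzWith.of_dist_le' fun u v => by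
    simpa only [dist_eq_norm] using hG.lipschitz k n u v).continuous

lemma continuous_blockStep {G : ∀ k, Fin (N k) → Model M → Model M}
    (hG : ∀ k n, Continuous (G k n)) (active : Fin K → Bool) (sample : ℕ → ∀ k, Fin (N k)) :
    Continuous (blockStep A G T μ active sample) := by
  have h1 : ∀ t, Continuous fun W => localIterate G μ active sample W t := by
    intro t
    induction t with
    | zero => exact continuous_id
    | succ t ih =>
      refine continuous_pi fun k => ?_
      have hk : Continuous fun W => localIterate G μ active sample W t k :=
        (continuous_apply k).comp ih
      have hGk := (hG k (sample t k)).comp hk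
      exact hk.sub (hGk.const_smul (stepSize μ (active k)))
  refine continuous_pi fun k => ?_
  unfold blockStep mix
  refine continuous_finsetSum _ fun l _ => ?_
  have hl : Continuous fun W => localIterate G μ active sample W T l :=
    (continuous_apply l).comp (h1 T)
  exact hl.const_smul (blockMatrix A active l k)

lemma continuous_lyapunov : Continuous (lyapunov wo : (Fin K → Model M) → ℝ) := by
  have h1 : Continuous (centroid : (Fin K → Model M) → Model M) := by
    unfold centroid
    fun_prop
  have h2 : Continuous (deviation : (Fin K → Model M) → Fin K → Model M) :=
    continuous_pi fun k => (continuous_apply k).sub h1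
  have h3 : Continuous (familyNorm : (Fin K → Model M) → ℝ) :=
    continuous_norm.comp (PiLp.continuous_toLp 2 _)
  exact ((h1.sub continuous_const).norm.pow 4).add ((h3.comp h2).pow 4)

/-- Integrating out first a variable `ξ` with finitely many values that is independent of `W`. -/
lemma lintegral_le_of_indepFun [MeasurableSpace Ω] {P : Measure Ω} [IsProbabilityMeasure P]
    {S Y : Type*} [MeasurableSpace S] [Fintype Y] [MeasurableSpace Y] [MeasurableSingletonClass Y]
    {W : Ω → S} {ξ : Ω → Y} (hW : Measurable W) (hξ : Measurable ξ) (hind : IndepFun W ξ P)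
    {f : S → Y → ℝ} {g : S → ℝ} (hf : ∀ y, Measurable fun w => f w y) (hf0 : ∀ w y, 0 ≤ f w y)
    (hg : Measurable g) (hg0 : ∀ w, 0 ≤ g w) {r s : ℝ} (hr : 0 ≤ r) (hs : 0 ≤ s)
    (hstep : ∀ w, ∑ y, P.real (ξ ⁻¹' {y}) * f w y ≤ r * g w + s) :
    ∫⁻ ω, ENNReal.ofReal (f (W ω) (ξ ω)) ∂P
      ≤ ENNReal.ofReal r * ∫⁻ ω, ENNReal.ofReal (g (W ω)) ∂P + ENNReal.ofReal s := by
  have hfm : Measurable fun p : S × Y => ENNReal.ofReal (f p.1 p.2) :=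
    measurable_from_prod_countable_left fun y => (hf y).ennreal_ofReal
  have h2 : ∀ w, ∫⁻ y, ENNReal.ofReal (f w y) ∂(P.map ξ) ≤ ENNReal.ofReal (r * g w + s) := by
    intro w
    rw [lintegral_fintype]
    refine le_trans (le_of_eq ?_) (ENNReal.ofReal_le_ofReal (hstep w))
    rw [ENNReal.ofReal_sum_of_nonneg fun y _ => mul_nonneg measureReal_nonneg (hf0 w y)]
    refine Finset.sum_congr rfl fun y _ => ?_
    rw [Measure.map_apply hξ (measurableSet_singleton y), ENNReal.ofReal_mul measureReal_nonneg,
      ofReal_measureReal, mul_comm]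
  calc ∫⁻ ω, ENNReal.ofReal (f (W ω) (ξ ω)) ∂P
      = ∫⁻ z, ENNReal.ofReal (f z.1 z.2) ∂(P.map fun ω => (W ω, ξ ω)) :=
        (lintegral_map hfm (hW.prodMk hξ)).symm
    _ = ∫⁻ w, ∫⁻ y, ENNReal.ofReal (f w y) ∂(P.map ξ) ∂(P.map W) := by
        rw [hind.map_prod_eq_prod_map_map hW.aemeasurable hξ.aemeasurable,
          lintegral_prod _ hfm.aemeasurable]
    _ ≤ ∫⁻ w, ENNReal.ofReal (r * g w + s) ∂(P.map W) := lintegral_mono h2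
    _ = ∫⁻ ω, (ENNReal.ofReal r * ENNReal.ofReal (g (W ω)) + ENNReal.ofReal s) ∂P := by
        rw [lintegral_map ((hg.const_mul r).add_const s).ennreal_ofReal hW]
        refine lintegral_congr fun ω => ?_
        rw [ENNReal.ofReal_add (mul_nonneg hr (hg0 _)) hs, ENNReal.ofReal_mul hr]
    _ = _ := by
        rw [lintegral_add_right _ measurable_const, lintegral_const_mul' _ _ ENNReal.ofReal_ne_top]
        simp

variable {active : ℕ → Fin K → Ω → Bool} {sample : ℕ → ∀ k : Fin K, Ω → Fin (N k)}

lemma iterate_succ_mul_eq_blockOutcome [NeZero T] (i : ℕ) (ω : Ω) :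
    iterate A Q x T μ (fun j l => active j l ω) (fun n l => sample n l ω) ((i + 1) * T)
      = blockStep A (lossGradient Q x) T μ (blockOutcome T active sample i ω).1
        (blockOutcome T active sample i ω).sampleAt
        (iterate A Q x T μ (fun j l => active j l ω) (fun n l => sample n l ω) (i * T)) := by
  rw [iterate_succ_mul (NeZero.pos T)]
  rfl

variable [MeasurableSpace Ω] {P : Measure Ω}

lemma IsAlgorithmRandomness.lintegral_lyapunov_succ_le [NeZero T] [IsProbabilityMeasure P]
    (h : IsAlgorithmRandomness q P active sample)
    (hcont : ∀ k n, Continuous (lossGradient Q x k n)) (i : ℕ) {r s : ℝ} (hr : 0 ≤ r) (hs : 0 ≤ s)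
    (hstep : ∀ W : Fin K → Model M,
      ∑ ξ : BlockOutcome N T, P.real (blockOutcome T active sample i ⁻¹' {ξ})
        * lyapunov wo (blockStep A (lossGradient Q x) T μ ξ.1 ξ.sampleAt W)
        ≤ r * lyapunov wo W + s) :
    ∫⁻ ω, ENNReal.ofReal (lyapunov wo (iterate A Q x T μ (fun j l => active j l ω)
        (fun n l => sample n l ω) ((i + 1) * T))) ∂P
      ≤ ENNReal.ofReal r * ∫⁻ ω, ENNReal.ofReal (lyapunov wo (iterate A Q x T μ
          (fun j l => active j l ω) (fun n l => sample n l ω) (i * T))) ∂P + ENNReal.ofReal s := by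
  simp only [iterate_succ_mul_eq_blockOutcome]
  exact lintegral_le_of_indepFun
    (measurable_iterate hcont _ (fun j l _ => h.measurable_active j l)
      fun s l _ => h.measurable_sample s l)
    (h.measurable_blockOutcome i) (h.indepFun_iterate hcont i)
    (f := fun W ξ => lyapunov wo (blockStep A (lossGradient Q x) T μ ξ.1 ξ.sampleAt W))
    (fun ξ => (continuous_lyapunov.comp (continuous_blockStep hcont _ _)).measurable)
    (fun _ _ => lyapunov_nonneg _ _) continuous_lyapunov.measurable
    (fun _ => lyapunov_nonneg _ _) hr hs hstep

end Recursion

/-- A sequence with `u (i + 1) ≤ r u i + s`, `r < 1`, has upper limit at most `s / (1 - r)`. -/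
lemma limsup_le_of_affine_recursion {u : ℕ → ℝ≥0∞} {r s u₀ : ℝ} (hr0 : 0 ≤ r) (hr1 : r < 1)
    (hs : 0 ≤ s) (hu₀ : 0 ≤ u₀) (h0 : u 0 ≤ ENNReal.ofReal u₀)
    (hu : ∀ i, u (i + 1) ≤ ENNReal.ofReal r * u i + ENNReal.ofReal s) :
    limsup u atTop ≤ ENNReal.ofReal (s / (1 - r)) := by
  have h1r : 0 < 1 - r := by linarith
  have hbound : ∀ i, u i ≤ ENNReal.ofReal (r ^ i * u₀ + s / (1 - r)) := by
    intro i
    induction i with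
    | zero =>
      refine h0.trans (ENNReal.ofReal_le_ofReal ?_)
      have : 0 ≤ s / (1 - r) := by positivity
      simpa using this
    | succ i ih =>
      have h2 : 0 ≤ r ^ i * u₀ + s / (1 - r) := by positivity
      calc u (i + 1) ≤ ENNReal.ofReal r * ENNReal.ofReal (r ^ i * u₀ + s / (1 - r))
            + ENNReal.ofReal s := (hu i).trans (by gcongr)
        _ = ENNReal.ofReal (r ^ (i + 1) * u₀ + s / (1 - r)) := by
            rw [← ENNReal.ofReal_mul hr0, ← ENNReal.ofReal_add (mul_nonneg hr0 h2) hs]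
            congr 1
            field_simp
            ring
  have hlim : Tendsto (fun i : ℕ => ENNReal.ofReal (r ^ i * u₀ + s / (1 - r))) atTop
      (nhds (ENNReal.ofReal (0 * u₀ + s / (1 - r)))) :=
    ENNReal.tendsto_ofReal
      (((tendsto_pow_atTop_nhds_zero_of_lt_one hr0 hr1).mul_const u₀).add_const _)
  rw [zero_mul, zero_add] at hlim
  exact (limsup_le_limsup (Eventually.of_forall hbound)).trans hlim.limsup_eq.le

end PartialDiffusion
end

open PartialDiffusion
theorem theorem2 {K M : ℕ} {X : Type*} {N : Fin K → ℕ} (hN : ∀ k, 0 < N k)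
    (T : ℕ) (hT : 1 ≤ T)
    (A : Matrix (Fin K) (Fin K) ℝ) (hA : IsCombinationMatrix A)
    (Q : Fin K → Model M → X → ℝ) (x : ∀ k, Fin (N k) → X)
    (ν δ : ℝ) (hν : 0 < ν) (hQ : IsRegularLoss Q x ν δ)
    (q : Fin K → ℝ) (hq : ∀ k, 0 < q k ∧ q k ≤ 1)
    (wo : Model M) (hwo : ∀ w, weightedRisk Q x q wo ≤ weightedRisk Q x q w) :
    ∃ μ₀ : ℝ, 0 < μ₀ ∧ ∃ C : ℝ, 0 ≤ C ∧
      ∀ (Ω : Type*) [MeasurableSpace Ω] (P : Measure Ω) [IsProbabilityMeasure P]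
        (active : ℕ → Fin K → Ω → Bool) (sample : ℕ → ∀ k : Fin K, Ω → Fin (N k)),
        IsAlgorithmRandomness q P active sample →
        ∀ μ : ℝ, 0 < μ → μ < μ₀ → ∀ k : Fin K,
          limsup (fun i : ℕ =>
            ∫⁻ ω, ‖wo - iterate A Q x T μ (fun j l => active j l ω) (fun n l => sample n l ω)
              (i * T) k‖ₑ ^ 4 ∂P) atTop ≤ ENNReal.ofReal (C * μ ^ 2) := by
  rcases Nat.eq_zero_or_pos K with rfl | hK
  · exact ⟨1, one_pos, 0, le_rfl, fun _ _ _ _ _ _ _ _ _ _ k => k.elim0⟩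
  have : NeZero T := ⟨by omega⟩
  have : Nonempty (Fin K) := ⟨⟨0, hK⟩⟩
  obtain ⟨L, hG⟩ := hQ.exists_isLipschitzOracle wo
  have hqsum : 0 < ∑ k, q k := Finset.sum_pos (fun k _ => (hq k).1) Finset.univ_nonempty
  obtain ⟨μ₀, b, C, hμ₀, hb, hbμ, hC, hstep⟩ := exists_expected_lyapunov_le hA hK hG hT hq
    (mul_pos hν hqsum) (hQ.le_inner_mean_lossGradient hK (fun k => (hq k).1) hwo)
  refine ⟨μ₀, hμ₀, 8 * (C / b), by positivity, ?_⟩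
  intro Ω _ P _ active sample hrand μ hμ0 hμ k
  have hbμ1 : b * μ < 1 := (mul_lt_mul_of_pos_left hμ hb).trans_le hbμ
  have hbμ0 : 0 < b * μ := mul_pos hb hμ0
  set u : ℕ → ℝ≥0∞ := fun i => ∫⁻ ω, ENNReal.ofReal (lyapunov wo (iterate A Q x T μ
    (fun j l => active j l ω) (fun n l => sample n l ω) (i * T))) ∂P with hu
  have hrec : ∀ i, u (i + 1) ≤ ENNReal.ofReal (1 - b * μ) * u i + ENNReal.ofReal (C * μ ^ 3) :=
    fun i => hrand.lintegral_lyapunov_succ_le hG.continuous i (by linarith) (by positivity)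
      (hstep _ _ _ _ (hrand.isBlockLaw hq i) μ hμ0 hμ)
  have h0 : u 0 ≤ ENNReal.ofReal (lyapunov wo fun _ : Fin K => (0 : Model M)) := by
    simp [hu, iterate]
  have hlim := limsup_le_of_affine_recursion (by linarith) (by linarith) (by positivity)
    (lyapunov_nonneg _ _) h0 hrec
  have hle : ∀ i : ℕ, ∫⁻ ω, ‖wo - iterate A Q x T μ (fun j l => active j l ω)
      (fun n l => sample n l ω) (i * T) k‖ₑ ^ 4 ∂P ≤ 8 * u i := by
    intro i
    rw [hu, ← lintegral_const_mul' _ _ (by norm_num)]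
    refine lintegral_mono fun ω => ?_
    rw [← ofReal_norm, ← ENNReal.ofReal_pow (norm_nonneg _)]
    refine (ENNReal.ofReal_le_ofReal (norm_sub_pow_four_le_lyapunov wo _ k)).trans ?_
    rw [ENNReal.ofReal_mul (by norm_num)]
    simp
  refine (limsup_le_limsup (Eventually.of_forall hle)).trans ?_
  rw [ENNReal.limsup_const_mul_of_ne_top (by norm_num)]
  calc 8 * limsup u atTop ≤ 8 * ENNReal.ofReal (C * μ ^ 3 / (1 - (1 - b * μ))) := by gcongr
    _ = ENNReal.ofReal (8 * (C / b) * μ ^ 2) := by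
        rw [show (8 : ℝ≥0∞) = ENNReal.ofReal 8 by simp, ← ENNReal.ofReal_mul (by norm_num)]
        congr 1
        field_simp
        ring
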